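/- **Conventions.** A (non-stationary) subdivision scheme is given by a sequence of real Laurent polynomials (symbols) $a^{(k)}(z)=\sum_{i\in\mathbb Z}a^{(k)}_iz^i$, $k\ge 0$. From initial data $q^{(0)}=q$ it produces $q^{(k+1)}=S_{a^{(k)}}q^{(k)}$, where $(S_{a^{(k)}}q)_i=\sum_{j\in\mathbb Z}a^{(k)}_{i-2j}q_j$. The values $q^{(k)}_i$ are attached to parameters $t^{(k)}_i=\tau_k+i\,2^{-k}$ (usually $\tau_k=0$), and $Q^{(k)}$ denotes the function that is affine on each $[t^{(k)}_i,t^{(k)}_{i+1}]$ with $Q^{(k)}(t^{(k)}_i)=q^{(k)}_i$. A function $g:\mathbb R\to\mathbb C$ is the limit function for the data $q$ if $Q^{(k)}\to g$ uniformly on bounded intervals. The scheme is *convergent* if a limit function exists for all initial data and is not identically zero for at least one choice of them. Let $T\ge 0$ and $\gamma=(\gamma_0,\dots,\gamma_T)\in\mathbb C^{T+1}$ with $\gamma_T\ne 0$, and let $$V_{T,\gamma}=\Big\{f\in C^T(\mathbb R;\mathbb C):\ \sum_{j=0}^T\gamma_jD^jf=0\Big\}.$$ A scheme *generates* $V_{T,\gamma}$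 if it is convergent and, for every $f\in V_{T,\gamma}$, the limit function for the initial data $q_i=f(t^{(0)}_i)$ belongs to $V_{T,\gamma}$; it *reproduces* $V_{T,\gamma}$ if it is convergent and this limit function is $f$ itself, for every $f\in V_{T,\gamma}$. Assume that distinct zeros of $\gamma(z)=\sum_{j=0}^T\gamma_jz^j$ never differ by an integer multiple of $2\pi\mathrm i$. **Proposition.** Let $\widehat a^{(k)}(z)$, $k\ge0$, be real polynomials, $n(k)=\deg\widehat a^{(k)}$, such that $\widehat a^{(k)}(z)$ and $\widehat a^{(k)}(-z)$ are relatively prime for every $k\ge 0$. Put $\ell^+=2$ and $\ell^-=1$. Suppose that the scheme with symbols $\widehat a^{(k)}$ and parameters $t^{(k)}_i=\tau_k+i\,2^{-k}$, for some real $\tau_k$, generates $V_{T,\gamma}$. Then: 1. For all $k\ge0$, $\star\in\{+,-\}$ and $1\le i\le n(k)$ there is exactly one real polynomial $p=p_i^{(k),\star}$ of degree less than $n(k)$ such that $$\widehat a^{(k)}(z)\,p(z)\ \star\ \widehat a^{(k)}(-z)\,p(-z)=2z^{2i-\ell^\star}.$$ 2. For every choice of $\star=\star(k)\in\{+,-\}$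 and $i=i(k)$ with $1\le i(k)\le n(k)$, $k\ge0$, the scheme with symbols $$m^{(k)}_{i}(z)=\frac{\widehat a^{(k)}(z)\,p_{i}^{(k),\star}(z)}{z^{2i-\ell^\star}},\qquad k\ge 0$$ (so $m_i^{(k)}(z)=\widehat a^{(k)}(z)p_i^{(k)}(z)/z^{2i-1}$ for $\star=-$) and parameters $t^{(k)}_i=\tau+i\,2^{-k}$, for any fixed real $\tau$, reproduces the same space $V_{T,\gamma}$ whenever it is convergent. -/

import Mathlib

open Polynomial LaurentPolynomial Filter Topology

namespace ExpSubdivision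

noncomputable section

/-! ### Subdivision schemes -/

/-- The subdivision operator with real symbol `a(z) = ∑ aᵢ zⁱ` (a Laurent polynomial, so that the
mask `aᵢ` is finitely supported): `(S_a q)ᵢ = ∑_j a_{i-2j} q_j`. Only finitely many terms of the
sum are non-zero. Data are complex so that complex-valued functions can be sampled. -/
def subdivOp (a : ℝ[T;T⁻¹]) (q : ℤ → ℂ) : ℤ → ℂ :=
  fun i => ∑ᶠ j : ℤ, (a.coeff (i - 2 * j) : ℂ) * q j

/-- The data `q^{(k)} = S_{a^{(k-1)}} ⋯ S_{a^{(0)}} q` produced by `k` steps of the scheme. -/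
def subdivData (a : ℕ → ℝ[T;T⁻¹]) (q : ℤ → ℂ) : ℕ → ℤ → ℂ
  | 0 => q
  | k + 1 => subdivOp (a k) (subdivData a q k)

/-- The parameter value `t_i^{(k)} = τ_k + i / 2^k`. Every choice of parameters with
`t_{i+1}^{(k)} - t_i^{(k)} = 2^{-k}` is of this form; the usual choice is `τ = 0`. -/
def gridPoint (τ : ℕ → ℝ) (k : ℕ) (i : ℤ) : ℝ := τ k + (i : ℝ) / 2 ^ k

/-- The function on `ℝ` that takes the value `q i` at `gridPoint τ k i` and is affine between
consecutive grid points. -/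
def polygon (τ : ℕ → ℝ) (k : ℕ) (q : ℤ → ℂ) (x : ℝ) : ℂ :=
  let u : ℝ := (x - τ k) * 2 ^ k
  ((1 - Int.fract u : ℝ) : ℂ) * q ⌊u⌋ + ((Int.fract u : ℝ) : ℂ) * q (⌊u⌋ + 1)

/-- `g` is the limit function of the scheme with symbols `a` for the initial data `q`: the
piecewise linear interpolants converge to `g`, uniformly on bounded intervals. -/
def IsLimitFunction (τ : ℕ → ℝ) (a : ℕ → ℝ[T;T⁻¹]) (q : ℤ → ℂ) (g : ℝ → ℂ) : Prop :=
  TendstoLocallyUniformly (fun k => polygon τ k (subdivData a q k)) g atTop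

/-- Convergence of a subdivision scheme: there is a limit function for all initial data, and it is
not identically zero for at least one choice of the initial data. -/
def Convergent (τ : ℕ → ℝ) (a : ℕ → ℝ[T;T⁻¹]) : Prop :=
  (∀ q : ℤ → ℂ, ∃ g : ℝ → ℂ, IsLimitFunction τ a q g) ∧
    ∃ (q : ℤ → ℂ) (g : ℝ → ℂ), IsLimitFunction τ a q g ∧ g ≠ 0

/-! ### Exponential polynomials -/

/-- The space `V_{T,γ}` of all `f : ℝ → ℂ` of class `C^T` with `∑_{j=0}^T γ_j D^j f = 0`. -/
def expPolySpace (T : ℕ) (γ : Fin (T + 1) → ℂ) : Set (ℝ → ℂ) :=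
  {f | ContDiff ℝ T f ∧ ∀ x : ℝ, ∑ j : Fin (T + 1), γ j * iteratedDeriv (j : ℕ) f x = 0}

/-- The polynomial `γ(z) = ∑_{j=0}^T γ_j z^j`. -/
def charPoly {T : ℕ} (γ : Fin (T + 1) → ℂ) : ℂ[X] :=
  ∑ j : Fin (T + 1), Polynomial.C (γ j) * Polynomial.X ^ (j : ℕ)

/-- The scheme is convergent and, from the samples of any `f ∈ V`, yields a limit function that
belongs to `V`. -/
def Generates (τ : ℕ → ℝ) (a : ℕ → ℝ[T;T⁻¹]) (V : Set (ℝ → ℂ)) : Prop :=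
  Convergent τ a ∧
    ∀ f ∈ V, ∃ g ∈ V, IsLimitFunction τ a (fun i => f (gridPoint τ 0 i)) g

/-- The scheme is convergent and, from the samples of any `f ∈ V`, yields the limit function `f`. -/
def Reproduces (τ : ℕ → ℝ) (a : ℕ → ℝ[T;T⁻¹]) (V : Set (ℝ → ℂ)) : Prop :=
  Convergent τ a ∧
    ∀ f ∈ V, IsLimitFunction τ a (fun i => f (gridPoint τ 0 i)) f

/-! ### From approximating to interpolatory symbols -/

/-- The choice `⋆ ∈ {+, -}`. -/
inductive Star
  | plus
  | minus

/-- The sign `±1` of `⋆`. -/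
def Star.sign : Star → ℝ
  | .plus => 1
  | .minus => -1

/-- The number `ℓ^⋆`: it is `2` for `+` and `1` for `-`. -/
def Star.ell : Star → ℕ
  | .plus => 2
  | .minus => 1

/-- The polynomial `a(-z)`. -/
def negArg (a : ℝ[X]) : ℝ[X] := a.comp (-Polynomial.X)

/-- `p` is the polynomial `p_i^⋆` attached to the degree-`n` polynomial `a`: it has degree less
than `n` and `a(z) p(z) ⋆ a(-z) p(-z) = 2 z^{2i - ℓ^⋆}`. (Used for `1 ≤ i`, where the subtraction
of natural numbers is the usual one.) -/
def IsBezoutPoly (a : ℝ[X]) (s : Star) (i : ℕ) (p : ℝ[X]) : Prop :=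
  p.degree < (a.natDegree : WithBot ℕ) ∧
    a * p + Polynomial.C s.sign * (negArg a * negArg p)
      = 2 * Polynomial.X ^ (2 * i - s.ell)

/-- The Laurent polynomial `a(z) p(z) / z^{2i - ℓ^⋆}`; for `⋆ = -` the denominator is
`z^{2i-1}`. -/
def interpSymbol (a : ℝ[X]) (s : Star) (i : ℕ) (p : ℝ[X]) : ℝ[T;T⁻¹] :=
  Polynomial.toLaurent (a * p) * LaurentPolynomial.T (-(2 * (i : ℤ) - (s.ell : ℤ)))

end

end ExpSubdivision

/-!
The limit functions of a convergent scheme are the convolutions `∑_j q_j φ(· - j)` of the data with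
the basic limit function `φ`, which is continuous and, by the Banach–Steinhaus theorem on the
sequence space, of compact support. The Laplace transform of `φ` is the limit of the
partial products of the symbol values `a^{(k)}(e^{-Λ/2^{k+1}})`, up to explicit factors which on any
compact set have no zeros from some index on.

Generation forces this transform to vanish at `θ + 2πim`, `m ≠ 0`, to at least the multiplicity of
the root `θ` of `γ` (the Strang–Fix conditions): otherwise the image of some `x^r e^{θx}` would have
a Fourier coefficient at a frequency that is not a root. By the minimum modulus principle a zero of
the limit is already a zero, of the same order, of a finite partial product. The symbol `m^{(k)}` is
a multiple of the symbol `a^{(k)}`, so the interpolatory scheme inherits these zeros. By Poisson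
summation it maps the samples of `x^r e^{θx}` to `P(x) e^{θx}` with a polynomial `P`, and
interpolation at infinitely many points determines `P`.
-/

noncomputable section

namespace ExpSubdivision

/-! ### Orders of vanishing of limits -/

section AnalyticOrder

variable {𝕜 E : Type*} [NontriviallyNormedField 𝕜] [NormedAddCommGroup E] [NormedSpace 𝕜 E]

theorem natCast_le_analyticOrderAt_iff_isBigO {f : 𝕜 → E} {z₀ : 𝕜} (hf : AnalyticAt 𝕜 f z₀)
    {n : ℕ} : n ≤ analyticOrderAt f z₀ ↔ f =O[𝓝 z₀] fun z => (z - z₀) ^ n := by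
  constructor
  · intro h
    obtain ⟨g, hg, hfg⟩ := (natCast_le_analyticOrderAt hf).1 h
    have hone : g =O[𝓝 z₀] fun _ => (1 : 𝕜) := hg.continuousAt.isBigO_one 𝕜
    simpa using EventuallyEq.trans_isBigO hfg
      ((Asymptotics.isBigO_refl (fun z => (z - z₀) ^ n) _).smul hone)
  · intro h
    by_contra! hlt
    obtain ⟨ν, hν⟩ := ENat.ne_top_iff_exists.1 hlt.ne_top
    rw [← hν, Nat.cast_lt] at hlt
    obtain ⟨g, hg, hg0, hfg⟩ := hf.analyticOrderAt_eq_natCast.1 hν.symm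
    have hpow : (fun z => (z - z₀) ^ ν) =O[𝓝 z₀] f := by
      have hone : (fun _ => (1 : 𝕜)) =O[𝓝 z₀] g :=
        Asymptotics.isBigO_const_left_iff_pos_le_norm one_ne_zero |>.2
          ⟨‖g z₀‖ / 2, half_pos (norm_pos_iff.2 hg0), hg.continuousAt.norm.eventually
            (le_mem_nhds (half_lt_self (norm_pos_iff.2 hg0)))⟩
      exact (((Asymptotics.isBigO_refl (fun z => (z - z₀) ^ ν) _).smul hone).congr_left
        fun z => mul_one _).trans_eventuallyEq (EventuallyEq.symm hfg)
    have hpow_o : (fun z => (z - z₀) ^ n) =o[𝓝 z₀] fun z => (z - z₀) ^ ν :=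
      .of_norm_norm (by simpa only [norm_pow] using Asymptotics.isLittleO_pow_sub_pow_sub z₀ hlt)
    refine Asymptotics.isLittleO_irrefl (Filter.Eventually.frequently ?_)
      (((hpow.trans h).trans_isLittleO hpow_o).mono nhdsWithin_le_nhds : _ =o[𝓝[≠] z₀] _)
    filter_upwards [self_mem_nhdsWithin] with z hz using pow_ne_zero _ (sub_ne_zero.2 hz)

theorem analyticOrderAt_le_of_isBigO {F : Type*} [NormedAddCommGroup F] [NormedSpace 𝕜 F]
    {f : 𝕜 → E} {g : 𝕜 → F} {z₀ : 𝕜} (hf : AnalyticAt 𝕜 f z₀) (hg : AnalyticAt 𝕜 g z₀)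
    (h : g =O[𝓝 z₀] f) : analyticOrderAt f z₀ ≤ analyticOrderAt g z₀ :=
  ENat.forall_natCast_le_iff_le.1 fun _ hn =>
    (natCast_le_analyticOrderAt_iff_isBigO hg).2
      (h.trans ((natCast_le_analyticOrderAt_iff_isBigO hf).1 hn))

theorem card_le_analyticOrderAt_prod {ι : Type*} {b : ι → 𝕜 → 𝕜} {z₀ : 𝕜} (s : Finset ι)
    (hb : ∀ j, AnalyticAt 𝕜 (b j) z₀) (h0 : ∀ j ∈ s, b j z₀ = 0) :
    (s.card : ℕ∞) ≤ analyticOrderAt (fun z => ∏ j ∈ s, b j z) z₀ := by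
  classical
  induction s using Finset.induction_on with
  | empty => simp
  | insert j s hj ih =>
    have hone : 1 ≤ analyticOrderAt (b j) z₀ :=
      Order.one_le_iff_ne_zero.2 ((hb j).analyticOrderAt_ne_zero.2 (h0 j (s.mem_insert_self j)))
    simp only [Finset.prod_insert hj, Finset.card_insert_of_notMem hj, Nat.cast_add, Nat.cast_one]
    rw [add_comm]
    exact (add_le_add hone (ih fun i hi => h0 i (Finset.mem_insert_of_mem hi))).trans_eq
      (analyticOrderAt_mul (hb j) (Finset.analyticAt_fun_prod _ fun i _ => hb i)).symm

theorem analyticOrderAt_le_mul {f g : 𝕜 → 𝕜} {z₀ : 𝕜} (hf : AnalyticAt 𝕜 f z₀)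
    (hg : AnalyticAt 𝕜 g z₀) : analyticOrderAt f z₀ ≤ analyticOrderAt (fun z => f z * g z) z₀ :=
  le_self_add.trans_eq (analyticOrderAt_mul hf hg).symm

end AnalyticOrder

theorem tendstoLocallyUniformlyOn_iteratedDeriv {ι : Type*} {l : Filter ι}
    {F : ι → ℂ → ℂ} {f : ℂ → ℂ} {U : Set ℂ} (hU : IsOpen U)
    (hF : ∀ᶠ k in l, DifferentiableOn ℂ (F k) U)
    (h : TendstoLocallyUniformlyOn F f l U) (n : ℕ) :
    TendstoLocallyUniformlyOn (fun k => iteratedDeriv n (F k)) (iteratedDeriv n f) l U := by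
  induction n with
  | zero => simpa using h
  | succ n ih =>
    simp only [iteratedDeriv_succ]
    refine ih.deriv (hF.mono fun k hk => ?_) hU
    intro z hz
    rw [iteratedDeriv_eq_iterate]
    exact (AnalyticAt.iterated_deriv (hk.analyticAt (hU.mem_nhds hz))
      n).differentiableAt.differentiableWithinAt

theorem le_analyticOrderAt_of_tendstoLocallyUniformly {ι : Type*} {l : Filter ι} [l.NeBot]
    {F : ι → ℂ → ℂ} {f : ℂ → ℂ} (hF : ∀ k, Differentiable ℂ (F k))
    (h : TendstoLocallyUniformly F f l) {z₀ : ℂ} {n : ℕ}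
    (hn : ∀ᶠ k in l, n ≤ analyticOrderAt (F k) z₀) : n ≤ analyticOrderAt f z₀ := by
  have hU := tendstoLocallyUniformlyOn_univ.2 h
  have hf := hU.differentiableOn (.of_forall fun k => (hF k).differentiableOn) isOpen_univ
  rw [natCast_le_analyticOrderAt_iff_iteratedDeriv_eq_zero (hf.analyticAt univ_mem)]
  intro s hs
  refine tendsto_nhds_unique (((tendstoLocallyUniformlyOn_iteratedDeriv isOpen_univ
    (.of_forall fun k => (hF k).differentiableOn) hU s).tendsto_at (Set.mem_univ z₀)))
    (tendsto_const_nhds.congr' (hn.mono fun k hk => ?_))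
  exact ((natCast_le_analyticOrderAt_iff_iteratedDeriv_eq_zero
    ((hF k).analyticAt z₀)).1 hk s hs).symm

theorem le_norm_of_forall_mem_sphere_le_norm {f : ℂ → ℂ} {z₀ : ℂ} {r ε : ℝ} (hr : 0 < r)
    (hε : 0 < ε) (hf : Differentiable ℂ f) (hne : ∀ z ∈ Metric.closedBall z₀ r, f z ≠ 0)
    (hle : ∀ z ∈ Metric.sphere z₀ r, ε ≤ ‖f z‖) :
    ∀ z ∈ Metric.closedBall z₀ r, ε ≤ ‖f z‖ := by
  intro z hz
  have hinv : ‖(f z)⁻¹‖ ≤ ε⁻¹ := by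
    refine Complex.norm_le_of_forall_mem_frontier_norm_le (U := Metric.ball z₀ r)
      (f := fun w => (f w)⁻¹) Metric.isBounded_ball
      (hf.diffContOnCl.inv fun w hw => hne w (Metric.closure_ball_subset_closedBall hw)) ?_
      (by rwa [closure_ball z₀ hr.ne'])
    intro w hw
    rw [frontier_ball z₀ hr.ne'] at hw
    rw [norm_inv]
    exact inv_anti₀ hε (hle w hw)
  rw [norm_inv] at hinv
  exact (inv_le_inv₀ (norm_pos_iff.2 (hne z hz)) hε).1 hinv

theorem exists_forall_mem_closedBall_ne_zero {f : ℂ → ℂ} (hf : Differentiable ℂ f) (hf0 : f ≠ 0)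
    (z₀ : ℂ) : ∃ r > 0, ∀ z ∈ Metric.closedBall z₀ r, z ≠ z₀ → f z ≠ 0 := by
  have hiso : ∀ᶠ z in 𝓝[≠] z₀, f z ≠ 0 := by
    refine (hf.analyticAt z₀).eventually_eq_zero_or_eventually_ne_zero.resolve_left fun h => hf0 ?_
    exact (hf.differentiableOn.analyticOnNhd isOpen_univ).eq_of_eventuallyEq
      (g := fun _ => 0) analyticOnNhd_const h
  obtain ⟨r, hr, hball⟩ := Metric.nhds_basis_closedBall.mem_iff.1
    (eventually_nhdsWithin_iff.1 hiso)
  exact ⟨r, hr, fun z hz hne => hball hz hne⟩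

theorem analyticOrderAt_le_of_tendsto_mul {ι : Type*} {l : Filter ι} [l.NeBot] {F P : ℂ → ℂ}
    {Q : ι → ℂ → ℂ} {z₀ : ℂ} {r : ℝ} (hr : 0 < r) (hF : Differentiable ℂ F)
    (hP : Differentiable ℂ P) (hQ : ∀ k, Differentiable ℂ (Q k))
    (hF0 : ∀ z ∈ Metric.sphere z₀ r, F z ≠ 0)
    (hQ0 : ∀ᶠ k in l, ∀ z ∈ Metric.closedBall z₀ r, Q k z ≠ 0)
    (hlim : TendstoUniformlyOn (fun k z => Q k z * P z) F l (Metric.closedBall z₀ r)) :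
    analyticOrderAt F z₀ ≤ analyticOrderAt P z₀ := by
  have hsphere := isCompact_sphere z₀ r
  obtain ⟨δ, hδ, hδF⟩ : ∃ δ > 0, ∀ z ∈ Metric.sphere z₀ r, δ ≤ ‖F z‖ :=
    hsphere.exists_forall_le' hF.continuous.norm.continuousOn fun z hz => norm_pos_iff.2 (hF0 z hz)
  obtain ⟨M, hM, hMP⟩ : ∃ M > 0, ∀ z ∈ Metric.sphere z₀ r, ‖P z‖ ≤ M :=
    let ⟨M, hM⟩ := hsphere.exists_bound_of_continuousOn hP.continuous.continuousOn
    ⟨max M 1, by positivity, fun z hz => (hM z hz).trans (le_max_left _ _)⟩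
  have hlower : ∀ᶠ k in l, ∀ z ∈ Metric.closedBall z₀ r, δ / 2 / M ≤ ‖Q k z‖ := by
    filter_upwards [hQ0, Metric.tendstoUniformlyOn_iff.1 hlim (δ / 2) (half_pos hδ)] with k hne hk
    refine le_norm_of_forall_mem_sphere_le_norm hr (by positivity) (hQ k) hne fun z hz => ?_
    have hFQ := hk z (Metric.sphere_subset_closedBall hz)
    rw [dist_eq_norm] at hFQ
    rw [div_le_iff₀ hM]
    calc δ / 2 ≤ ‖Q k z * P z‖ := by
          linarith [hδF z hz, norm_sub_norm_le (F z) (Q k z * P z)]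
      _ ≤ ‖Q k z‖ * M := by rw [norm_mul]; gcongr; exact hMP z hz
  have hPF : ∀ z ∈ Metric.closedBall z₀ r, δ / 2 / M * ‖P z‖ ≤ ‖F z‖ := by
    intro z hz
    refine ge_of_tendsto (hlim.tendsto_at hz).norm (hlower.mono fun k hk => ?_)
    rw [norm_mul]
    gcongr
    exact hk z hz
  refine analyticOrderAt_le_of_isBigO (hF.analyticAt z₀) (hP.analyticAt z₀)
    (Asymptotics.IsBigO.of_bound (δ / 2 / M)⁻¹ ?_)
  filter_upwards [Metric.closedBall_mem_nhds z₀ hr] with z hz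
  rw [le_inv_mul_iff₀ (by positivity)]
  exact hPF z hz

section InfiniteProduct

variable {F : ℂ → ℂ} {b e : ℕ → ℂ → ℂ}

theorem finite_setOf_eq_zero_of_analyticOrderAt_prod_lt {z₀ : ℂ}
    (hb : ∀ j, AnalyticAt ℂ (b j) z₀) {n : ℕ}
    (h : ∀ k, analyticOrderAt (fun z => ∏ j ∈ Finset.range k, b j z) z₀ < n) :
    {j | b j z₀ = 0}.Finite := by
  by_contra hinf
  obtain ⟨s, hs, hcard⟩ := Set.Infinite.exists_subset_card_eq hinf n
  obtain ⟨k, hk⟩ := s.exists_nat_subset_range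
  refine (h k).not_ge ?_
  have hprod : ∀ t : Finset ℕ, AnalyticAt ℂ (fun z => ∏ j ∈ t, b j z) z₀ := fun t =>
    Finset.analyticAt_fun_prod t fun j _ => hb j
  calc (n : ℕ∞) = s.card := by rw [hcard]
    _ ≤ analyticOrderAt (fun z => ∏ j ∈ s, b j z) z₀ := card_le_analyticOrderAt_prod s hb hs
    _ ≤ analyticOrderAt (fun z => (∏ j ∈ s, b j z) * ∏ j ∈ Finset.range k \ s, b j z) z₀ :=
      analyticOrderAt_le_mul (hprod s) (hprod _)
    _ = analyticOrderAt (fun z => ∏ j ∈ Finset.range k, b j z) z₀ := by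
      simp only [mul_comm (Finset.prod s _), Finset.prod_sdiff hk]

theorem eq_zero_of_tendsto_mul_prod {M : Type*} [CommMonoidWithZero M] [TopologicalSpace M]
    [T2Space M] {u v : ℕ → M} {w : M}
    (h : Tendsto (fun k => v k * ∏ j ∈ Finset.range k, u j) atTop (𝓝 w)) {j : ℕ}
    (hj : u j = 0) : w = 0 := by
  refine tendsto_nhds_unique h (tendsto_const_nhds.congr' ?_)
  filter_upwards [eventually_gt_atTop j] with k hk
  rw [Finset.prod_eq_zero (Finset.mem_range.2 hk) hj, mul_zero]

theorem exists_forall_ge_ne_zero_of_analyticOrderAt_prod_lt {z₀ : ℂ}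
    (hb : ∀ j, AnalyticAt ℂ (b j) z₀) {n : ℕ∞} (hn : n ≠ ⊤)
    (h : ∀ k, analyticOrderAt (fun z => ∏ j ∈ Finset.range k, b j z) z₀ < n) :
    ∃ N, ∀ j ≥ N, b j z₀ ≠ 0 := by
  lift n to ℕ using hn
  obtain ⟨N, hN⟩ := (finite_setOf_eq_zero_of_analyticOrderAt_prod_lt hb h).bddAbove
  exact ⟨N + 1, fun j hj h0 => (hN h0).not_gt hj⟩

theorem exists_analyticOrderAt_le_prod (hb : ∀ j, Differentiable ℂ (b j))
    (he : ∀ k, Differentiable ℂ (e k)) (hF0 : F ≠ 0)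
    (hlim : TendstoLocallyUniformly (fun k z => e k z * ∏ j ∈ Finset.range k, b j z) F atTop)
    (hne : ∀ K : Set ℂ, IsCompact K → ∀ᶠ k in atTop, ∀ z ∈ K, e k z ≠ 0) (z₀ : ℂ) :
    ∃ k, analyticOrderAt F z₀ ≤ analyticOrderAt (fun z => ∏ j ∈ Finset.range k, b j z) z₀ := by
  by_contra! hlt
  have hprod : ∀ s : Finset ℕ, Differentiable ℂ fun z => ∏ j ∈ s, b j z := fun s =>
    Differentiable.fun_finsetProd fun j _ => hb j
  have hF : Differentiable ℂ F := differentiableOn_univ.1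
    ((tendstoLocallyUniformlyOn_univ.2 hlim).differentiableOn
      (.of_forall fun k => ((he k).mul (hprod _)).differentiableOn) isOpen_univ)
  obtain ⟨r, hr, hFr⟩ := exists_forall_mem_closedBall_ne_zero hF hF0 z₀
  have hcompact := isCompact_closedBall z₀ r
  have hzero : ∀ j, ∀ z ∈ Metric.closedBall z₀ r, b j z = 0 → z = z₀ := fun j z hz h0 =>
    by_contra fun hne => hFr z hz hne (eq_zero_of_tendsto_mul_prod
      ((tendstoLocallyUniformlyOn_univ.2 hlim).tendsto_at (Set.mem_univ z)) h0)
  obtain ⟨N, hN⟩ := exists_forall_ge_ne_zero_of_analyticOrderAt_prod_lt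
    (fun j => (hb j).analyticAt z₀)
    (mt (AnalyticOnNhd.analyticOrderAt_eq_top_iff_eq_zero z₀ fun z => hF.analyticAt z).1 hF0) hlt
  refine (hlt N).not_ge (analyticOrderAt_le_of_tendsto_mul (l := atTop) hr hF (hprod _)
    (Q := fun k z => e k z * ∏ j ∈ Finset.Ico N k, b j z) (fun k => (he k).mul (hprod _))
    (fun z hz => hFr z (Metric.sphere_subset_closedBall hz) (Metric.ne_of_mem_sphere hz hr.ne'))
    ?_ ?_)
  · filter_upwards [hne _ hcompact] with k hk z hz
    refine mul_ne_zero (hk z hz) (Finset.prod_ne_zero_iff.2 fun j hj h0 => ?_)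
    rw [hzero j z hz h0] at h0
    exact hN j (Finset.mem_Ico.1 hj).1 h0
  · refine ((tendstoLocallyUniformly_iff_forall_isCompact.1 hlim) _ hcompact).congr ?_
    filter_upwards [eventually_ge_atTop N] with k hk z _
    simp only
    rw [mul_assoc, mul_comm (∏ j ∈ Finset.Ico _ _, _), Finset.prod_range_mul_prod_Ico _ hk]

end InfiniteProduct

/-! ### The Laplace transform -/

/-- The two-sided Laplace transform `Λ ↦ ∫ e^{-Λy} φ(y) dy`, used for continuous functions of
compact support, for which it is entire. -/
def laplace (φ : ℝ → ℂ) (Λ : ℂ) : ℂ :=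
  ∫ y : ℝ, Complex.exp (-(Λ * y)) * φ y

section Laplace

open MeasureTheory
open scoped FourierTransform

variable {φ : ℝ → ℂ}

theorem integrable_exp_mul (hφ : Continuous φ) (hc : HasCompactSupport φ) (Λ : ℂ) :
    Integrable fun y : ℝ => Complex.exp (-(Λ * y)) * φ y :=
  (Continuous.mul (by fun_prop) hφ).integrable_of_hasCompactSupport hc.mul_left

theorem norm_exp_neg_mul_le {Λ : ℂ} {r : ℝ} (hΛ : ‖Λ‖ ≤ r) (y : ℝ) :
    ‖Complex.exp (-(Λ * y))‖ ≤ Real.exp (r * |y|) := by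
  refine (Complex.norm_exp_le_exp_norm _).trans (Real.exp_le_exp.2 ?_)
  rw [norm_neg, norm_mul, Complex.norm_real, Real.norm_eq_abs]
  gcongr

theorem hasDerivAt_laplace (hφ : Continuous φ) (hc : HasCompactSupport φ) (Λ : ℂ) :
    HasDerivAt (laplace φ) (laplace (fun y => -y * φ y) Λ) Λ := by
  have hbound : Integrable fun y : ℝ => Real.exp ((‖Λ‖ + 1) * |y|) * ‖-(y : ℂ) * φ y‖ :=
    (Continuous.mul (by fun_prop) (by fun_prop)).integrable_of_hasCompactSupport
      (hc.mul_left (f := fun y : ℝ => -(y : ℂ))).norm.mul_left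
  refine (hasDerivAt_integral_of_dominated_loc_of_deriv_le (Metric.ball_mem_nhds Λ one_pos)
    (F' := fun Λ y => Complex.exp (-(Λ * y)) * (-y * φ y))
    (.of_forall fun z => (integrable_exp_mul hφ hc z).aestronglyMeasurable)
    (integrable_exp_mul hφ hc Λ) (Continuous.aestronglyMeasurable (by fun_prop))
    (.of_forall fun y z hz => ?_) hbound (.of_forall fun y z _ => ?_)).2
  · rw [norm_mul]
    gcongr
    refine norm_exp_neg_mul_le ?_ y
    rw [Metric.mem_ball, dist_eq_norm] at hz
    linarith [norm_sub_norm_le z Λ]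
  · have h := (((hasDerivAt_id z).mul_const (y : ℂ)).neg.cexp).mul_const (φ y)
    simpa [mul_assoc] using h

theorem differentiable_laplace (hφ : Continuous φ) (hc : HasCompactSupport φ) :
    Differentiable ℂ (laplace φ) :=
  fun Λ => (hasDerivAt_laplace hφ hc Λ).differentiableAt

theorem iteratedDeriv_laplace (hφ : Continuous φ) (hc : HasCompactSupport φ) (s : ℕ) :
    iteratedDeriv s (laplace φ) = laplace fun y => (-y) ^ s * φ y := by
  induction s with
  | zero => simp
  | succ s ih =>
    ext Λ
    rw [iteratedDeriv_succ, ih,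
      (hasDerivAt_laplace (φ := fun y => (-y) ^ s * φ y) (by fun_prop) hc.mul_left Λ).deriv]
    simp only [pow_succ', mul_assoc]

theorem le_analyticOrderAt_laplace_iff (hφ : Continuous φ) (hc : HasCompactSupport φ) {n : ℕ}
    {Λ : ℂ} : n ≤ analyticOrderAt (laplace φ) Λ ↔
      ∀ s < n, laplace (fun y => (-y) ^ s * φ y) Λ = 0 := by
  simp only [natCast_le_analyticOrderAt_iff_iteratedDeriv_eq_zero
    ((differentiable_laplace hφ hc).analyticAt Λ), iteratedDeriv_laplace hφ hc]

theorem laplace_comp_sub (φ : ℝ → ℂ) (c : ℝ) (Λ : ℂ) :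
    laplace (fun y => φ (y - c)) Λ = Complex.exp (-(Λ * c)) * laplace φ Λ := by
  rw [laplace, ← integral_add_right_eq_self _ c, laplace, ← integral_const_mul]
  refine integral_congr_ae (.of_forall fun y => ?_)
  simp only [add_sub_cancel_right, ← mul_assoc, ← Complex.exp_add]
  congr 2
  push_cast
  ring

theorem laplace_comp_mul (φ : ℝ → ℂ) {r : ℝ} (hr : 0 < r) (Λ : ℂ) :
    laplace (fun y => φ (y * r)) Λ = (r : ℂ)⁻¹ * laplace φ (Λ / r) := by
  have h := Measure.integral_comp_mul_right (fun y => Complex.exp (-(Λ / r * y)) * φ y) r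
  rw [abs_of_pos (inv_pos.2 hr), Complex.real_smul, Complex.ofReal_inv] at h
  rw [laplace, laplace, ← h]
  refine integral_congr_ae (.of_forall fun y => ?_)
  have : (r : ℂ) ≠ 0 := Complex.ofReal_ne_zero.2 hr.ne'
  simp only
  congr 3
  push_cast
  field_simp

theorem laplace_sum_mul {ι : Type*} (s : Finset ι) (q : ι → ℂ) {ψ : ι → ℝ → ℂ}
    (hψ : ∀ i, Continuous (ψ i)) (hc : ∀ i, HasCompactSupport (ψ i)) (Λ : ℂ) :
    laplace (fun y => ∑ i ∈ s, q i * ψ i y) Λ = ∑ i ∈ s, q i * laplace (ψ i) Λ := by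
  simp only [laplace, Finset.mul_sum, mul_left_comm _ (q _)]
  rw [integral_finsetSum _ fun i _ => (integrable_exp_mul (hψ i) (hc i) Λ).const_mul (q i)]
  simp only [integral_const_mul]

theorem laplace_add_two_pi_I_mul (φ : ℝ → ℂ) (θ : ℂ) (ξ : ℝ) :
    laplace φ (θ + 2 * Real.pi * Complex.I * ξ) =
      𝓕 (fun y : ℝ => Complex.exp (-(θ * y)) * φ y) ξ := by
  rw [laplace, Real.fourier_real_eq_integral_exp_smul]
  refine integral_congr_ae (.of_forall fun y => ?_)
  simp only [smul_eq_mul, ← mul_assoc, ← Complex.exp_add]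
  congr 2
  push_cast
  ring

theorem laplace_ne_zero (hφ : Continuous φ) (hc : HasCompactSupport φ) (h0 : φ ≠ 0) :
    laplace φ ≠ 0 := by
  intro h
  have hF : 𝓕 φ = 0 := by
    ext ξ
    simpa [h] using (laplace_add_two_pi_I_mul φ 0 ξ).symm
  have hinv := hφ.fourierInv_fourier_eq (hφ.integrable_of_hasCompactSupport hc)
    (hF ▸ integrable_zero _ _ _)
  refine h0 (hinv.symm.trans ?_)
  ext x
  simp [hF, Real.fourierInv_eq]

theorem tendstoLocallyUniformly_laplace {ι : Type*} {l : Filter ι} [l.NeBot]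
    {ψ : ι → ℝ → ℂ} {K : Set ℝ}
    (hK : IsCompact K) (hψ : ∀ k, Continuous (ψ k)) (hsupp : ∀ k, ∀ y ∉ K, ψ k y = 0)
    (hlim : TendstoLocallyUniformly ψ φ l) :
    TendstoLocallyUniformly (fun k => laplace (ψ k)) (laplace φ) l := by
  have hφ : Continuous φ := hlim.continuous (.of_forall hψ)
  have hsuppφ : ∀ y ∉ K, φ y = 0 := fun y hy =>
    tendsto_nhds_unique ((tendstoLocallyUniformlyOn_univ.2 hlim).tendsto_at (Set.mem_univ y))
      (tendsto_const_nhds.congr fun k => (hsupp k y hy).symm)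
  have hdiff : ∀ k Λ, laplace φ Λ - laplace (ψ k) Λ =
      ∫ y in K, Complex.exp (-(Λ * y)) * (φ y - ψ k y) := by
    intro k Λ
    rw [laplace, laplace, ← integral_sub (integrable_exp_mul hφ (.intro hK hsuppφ) Λ)
      (integrable_exp_mul (hψ k) (.intro hK (hsupp k)) Λ),
      setIntegral_eq_integral_of_forall_compl_eq_zero fun y hy => by
        rw [hsuppφ y hy, hsupp k y hy, sub_zero, mul_zero]]
    simp only [mul_sub]
  refine tendstoLocallyUniformly_iff_forall_isCompact.2 fun C hC => ?_
  obtain ⟨M, hM⟩ := (hC.prod hK).exists_bound_of_continuousOn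
    (f := fun p : ℂ × ℝ => Complex.exp (-(p.1 * p.2))) (by fun_prop)
  refine Metric.tendstoUniformlyOn_iff.2 fun ε hε => ?_
  have hB : 0 < (|M| + 1) * (volume.real K + 1) := by positivity
  filter_upwards [Metric.tendstoUniformlyOn_iff.1
    (tendstoLocallyUniformly_iff_forall_isCompact.1 hlim K hK) _ (div_pos hε hB)] with k hk Λ hΛ
  rw [dist_eq_norm, hdiff]
  calc ‖∫ y in K, Complex.exp (-(Λ * y)) * (φ y - ψ k y)‖
      ≤ |M| * (ε / ((|M| + 1) * (volume.real K + 1))) * volume.real K := by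
        refine norm_setIntegral_le_of_norm_le_const hK.measure_lt_top fun y hy => ?_
        rw [norm_mul, ← dist_eq_norm]
        gcongr
        exacts [(hM (Λ, y) ⟨hΛ, hy⟩).trans (le_abs_self M), (hk y hy).le]
    _ < (|M| + 1) * (ε / ((|M| + 1) * (volume.real K + 1))) * (volume.real K + 1) := by
        gcongr <;> linarith
    _ = ε := by field_simp

end Laplace

/-! ### Semi-discrete convolution -/

/-- The semi-discrete convolution `∑_j q_j φ(· - j)`, used for `φ` of compact support, where the
sum is finite at each point. -/
def semiConv (q : ℤ → ℂ) (φ : ℝ → ℂ) (x : ℝ) : ℂ :=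
  ∑' j : ℤ, q j * φ (x - j)

section SemiConv

open MeasureTheory Pointwise

variable {φ : ℝ → ℂ}

theorem exists_finset_forall_sub_notMem {K K' : Set ℝ} (hK : IsCompact K) (hK' : IsCompact K') :
    ∃ s : Finset ℤ, ∀ x ∈ K, ∀ j ∉ s, x - (j : ℤ) ∉ K' := by
  have hfin : ((Int.cast : ℤ → ℝ) ⁻¹' (K - K')).Finite :=
    (Int.isClosedEmbedding_coe_real.isCompact_preimage
      (sub_eq_add_neg K K' ▸ hK.add hK'.neg)).finite_of_discrete
  refine ⟨hfin.toFinset, fun x hx j hj h => hj ?_⟩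
  rw [Set.Finite.mem_toFinset]
  exact ⟨x, hx, x - j, h, sub_sub_cancel _ _⟩

theorem exists_finset_forall_comp_sub_eq_zero (hc : HasCompactSupport φ) {K : Set ℝ}
    (hK : IsCompact K) : ∃ s : Finset ℤ, ∀ x ∈ K, ∀ j ∉ s, φ (x - (j : ℤ)) = 0 := by
  obtain ⟨s, hs⟩ := exists_finset_forall_sub_notMem hK hc.isCompact
  exact ⟨s, fun x hx j hj => image_eq_zero_of_notMem_tsupport (hs x hx j hj)⟩

theorem hasFiniteSupport_comp_sub (hc : HasCompactSupport φ) (x : ℝ) :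
    (Function.support fun j : ℤ => φ (x - j)).Finite := by
  obtain ⟨s, hs⟩ := exists_finset_forall_comp_sub_eq_zero hc (isCompact_singleton (x := x))
  exact s.finite_toSet.subset fun j hj => by_contra fun hjs => hj (hs x rfl j hjs)

theorem summable_mul_comp_sub (hc : HasCompactSupport φ) (q : ℤ → ℂ) (x : ℝ) :
    Summable fun j : ℤ => q j * φ (x - j) :=
  summable_of_hasFiniteSupport ((hasFiniteSupport_comp_sub hc x).subset
    (Function.support_mul_subset_right _ _))

theorem semiConv_pow_mul_exp (hc : HasCompactSupport φ) (r : ℕ) (θ : ℂ) (x : ℝ) :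
    semiConv (fun j => j ^ r * Complex.exp (θ * j)) φ x =
      ∑ s ∈ Finset.range (r + 1), x ^ (r - s) * r.choose s *
        semiConv (fun j => Complex.exp (θ * j)) (fun y => (-y) ^ s * φ y) x := by
  have hexpand : ∀ j : ℤ, (j : ℂ) ^ r * Complex.exp (θ * j) * φ (x - j) =
      ∑ s ∈ Finset.range (r + 1), x ^ (r - s) * r.choose s *
        (Complex.exp (θ * j) * ((-(x - j : ℝ)) ^ s * φ (x - j))) := by
    intro j
    rw [show (j : ℂ) = -(x - j : ℝ) + x by push_cast; ring, add_pow, Finset.sum_mul, Finset.sum_mul]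
    refine Finset.sum_congr rfl fun s _ => ?_
    ring
  simp only [semiConv, hexpand, ← tsum_mul_left]
  exact Summable.tsum_finsetSum fun s _ =>
    (summable_mul_comp_sub (φ := fun y => (-y) ^ s * φ y) hc.mul_left _ x).mul_left _

theorem semiConv_exp_eq_of_laplace_eq_zero (hφ : Continuous φ) (hc : HasCompactSupport φ) {θ : ℂ}
    (h0 : ∀ m : ℤ, m ≠ 0 → laplace φ (θ + 2 * Real.pi * Complex.I * m) = 0) (x : ℝ) :
    semiConv (fun j => Complex.exp (θ * j)) φ x = laplace φ θ * Complex.exp (θ * x) := by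
  set f : ℝ → ℂ := fun y => Complex.exp (-(θ * y)) * φ y with hf
  have hfourier : ∀ m : ℤ, FourierTransform.fourier f (m : ℝ) =
      laplace φ (θ + 2 * Real.pi * Complex.I * m) := fun m => by
    simpa using (laplace_add_two_pi_I_mul φ θ m).symm
  have hf_zero : f =ᶠ[cocompact ℝ] 0 := by
    rw [← coclosedCompact_eq_cocompact]
    exact hasCompactSupport_iff_eventuallyEq.1 hc.mul_left
  have hdecay : f =O[cocompact ℝ] fun x => |x| ^ (-2 : ℝ) :=
    hf_zero.trans_isBigO (Asymptotics.isBigO_zero _ _)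
  have hsummable : Summable fun m : ℤ => FourierTransform.fourier f m :=
    summable_of_ne_finset_zero (s := {0}) fun m hm => by
      rw [hfourier, h0 m (by simpa using hm)]
  have hpoisson : ∑' m : ℤ, f (x + m) = laplace φ θ := by
    rw [Real.tsum_eq_tsum_fourier_of_rpow_decay_of_summable (f := f) (by fun_prop) one_lt_two
      hdecay hsummable x]
    refine (tsum_eq_single 0 fun m hm => by rw [hfourier, h0 m hm, zero_mul]).trans ?_
    rw [hfourier]
    simp only [Int.cast_zero, mul_zero, add_zero, fourier_zero, mul_one]
  rw [← hpoisson, semiConv, ← (Equiv.neg ℤ).tsum_eq, ← tsum_mul_right]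
  refine tsum_congr fun n => ?_
  simp only [hf, mul_right_comm _ (φ _), ← Complex.exp_add, Equiv.neg_apply]
  congr 2 <;> push_cast <;> ring

theorem integral_exp_mul_semiConv_exp (hφ : Continuous φ) (hc : HasCompactSupport φ) {θ Λ : ℂ}
    (hΛ : Complex.exp Λ = Complex.exp θ) :
    ∫ x in (0 : ℝ)..1, Complex.exp (-(Λ * x)) * semiConv (fun j => Complex.exp (θ * j)) φ x =
      laplace φ Λ := by
  have hexp : ∀ (x : ℝ) (j : ℤ), Complex.exp (-(Λ * x)) * (Complex.exp (θ * j) * φ (x - j)) =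
      Complex.exp (-(Λ * (x - j : ℝ))) * φ (x - j) := by
    intro x j
    rw [mul_comm θ, Complex.exp_int_mul, ← hΛ, ← Complex.exp_int_mul, ← mul_assoc,
      ← Complex.exp_add]
    congr 2
    push_cast
    ring
  obtain ⟨s, hs⟩ := exists_finset_forall_comp_sub_eq_zero hc
    (isCompact_Icc (a := (0 : ℝ)) (b := 1))
  have hsum : ∀ x ∈ Set.uIcc (0 : ℝ) 1,
      Complex.exp (-(Λ * x)) * semiConv (fun j => Complex.exp (θ * j)) φ x =
        ∑ j ∈ s, Complex.exp (-(Λ * (x - j : ℝ))) * φ (x - j) := by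
    intro x hx
    rw [Set.uIcc_of_le zero_le_one] at hx
    rw [semiConv, tsum_eq_sum fun j hj => by rw [hs x hx j hj, mul_zero], Finset.mul_sum]
    exact Finset.sum_congr rfl fun j _ => hexp x j
  have hzero : ∀ j ∉ s,
      ∫ x in (0 : ℝ)..1, Complex.exp (-(Λ * (x - j : ℝ))) * φ (x - j) = 0 := by
    intro j hj
    refine (intervalIntegral.integral_congr fun x hx => ?_).trans intervalIntegral.integral_zero
    rw [Set.uIcc_of_le zero_le_one] at hx
    simp only [hs x hx j hj, mul_zero]
  have htotal := (integrable_exp_mul hφ hc Λ).hasSum_intervalIntegral_comp_add_int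
  rw [← (Equiv.neg ℤ).hasSum_iff] at htotal
  simp only [Function.comp_def, Equiv.neg_apply, Int.cast_neg, ← sub_eq_add_neg] at htotal
  rw [intervalIntegral.integral_congr hsum, intervalIntegral.integral_finsetSum fun j _ =>
    Continuous.intervalIntegrable (by fun_prop) _ _]
  exact (hasSum_sum_of_ne_finset_zero hzero).unique htotal

end SemiConv

theorem continuous_semiConv {φ : ℝ → ℂ} (hφ : Continuous φ) (hc : HasCompactSupport φ)
    (q : ℤ → ℂ) : Continuous (semiConv q φ) := by
  refine continuous_iff_continuousAt.2 fun x => ?_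
  obtain ⟨s, hs⟩ := exists_finset_forall_comp_sub_eq_zero hc
    (isCompact_Icc (a := x - 1) (b := x + 1))
  have hsum : semiConv q φ =ᶠ[𝓝 x] fun y => ∑ j ∈ s, q j * φ (y - j) := by
    filter_upwards [Icc_mem_nhds (sub_one_lt x) (lt_add_one x)] with y hy
    exact tsum_eq_sum fun j hj => by rw [hs y hy j hj, mul_zero]
  exact ContinuousAt.congr (by fun_prop) hsum.symm

theorem exists_finset_forall_eq_zero_of_bddAbove {ι κ 𝕜 : Type*} [Countable κ]
    [NontriviallyNormedField 𝕜] [CompleteSpace 𝕜] {ℓ : ι → (κ → 𝕜) →L[𝕜] 𝕜}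
    (hb : ∀ q, BddAbove (Set.range fun i => ‖ℓ i q‖)) :
    ∃ s : Finset κ, ∀ i q, (∀ j ∈ s, q j = 0) → ℓ i q = 0 := by
  have hequi : Equicontinuous ((↑) ∘ ℓ : ι → (κ → 𝕜) → 𝕜) :=
    ((norm_withSeminorms 𝕜 𝕜).banach_steinhaus fun _ => hb).equicontinuous
  have hU : ∀ᶠ q in 𝓝 (0 : κ → 𝕜), ∀ i, ‖ℓ i q‖ < 1 := by
    simpa using Metric.equicontinuousAt_iff_right.1 (hequi 0) 1 one_pos
  rw [nhds_pi, Filter.Eventually, Filter.mem_pi'] at hU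
  obtain ⟨s, t, ht, hst⟩ := hU
  refine ⟨s, fun i q hq => by_contra fun hne => ?_⟩
  have hmem : (ℓ i q)⁻¹ • q ∈ (s : Set κ).pi t := fun j hj => by
    simpa [hq j hj] using mem_of_mem_nhds (ht j)
  simpa [hne] using hst hmem i

theorem bddAbove_range_norm_of_tendstoLocallyUniformly {X E : Type*} [TopologicalSpace X]
    [SeminormedAddCommGroup E] {f : ℕ → X → E} {g : X → E} (hf : ∀ k, Continuous (f k))
    (hlim : TendstoLocallyUniformly f g atTop) {K : Set X} (hK : IsCompact K) :
    BddAbove (Set.range fun i : ℕ × K => ‖f i.1 i.2‖) := by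
  have := isCompact_iff_compactSpace.1 hK
  have hg : Continuous g := hlim.continuous (.of_forall hf)
  let F : ℕ → C(K, E) := fun k => ⟨fun x => f k x, by fun_prop⟩
  have hF : Tendsto F atTop (𝓝 ⟨fun x => g x, by fun_prop⟩) :=
    ContinuousMap.tendsto_iff_tendstoLocallyUniformly.2
      (hlim.comp Subtype.val continuous_subtype_val)
  obtain ⟨C, hC⟩ := (Metric.isBounded_range_of_tendsto F hF).exists_norm_le
  refine ⟨C, Set.forall_mem_range.2 fun i => ?_⟩
  exact ((F i.1).norm_coe_le_norm i.2).trans (hC _ ⟨i.1, rfl⟩)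

/-! ### Subdivision steps as continuous linear maps -/

section SubdivOp

variable (a : ℝ[T;T⁻¹])

theorem hasFiniteSupport_coeff_sub (i : ℤ) :
    (Function.support fun j : ℤ => (a.coeff (i - 2 * j) : ℂ)).Finite := by
  refine (a.coeff.support.finite_toSet.preimage (f := fun j : ℤ => i - 2 * j)
    fun j _ j' _ h => by simpa using h).subset fun j hj => ?_
  simpa using hj

theorem subdivOp_eq_sum (q : ℤ → ℂ) (i : ℤ) :
    subdivOp a q i =
      ∑ j ∈ (hasFiniteSupport_coeff_sub a i).toFinset, (a.coeff (i - 2 * j) : ℂ) * q j :=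
  finsum_eq_sum_of_support_subset _ <| by
    simp

theorem subdivOp_shift (q : ℤ → ℂ) (n i : ℤ) :
    subdivOp a (fun j => q (j - n)) i = subdivOp a q (i - 2 * n) := by
  rw [subdivOp, subdivOp, ← finsum_comp_equiv (Equiv.addRight n)]
  refine finsum_congr fun j => ?_
  simp only [Equiv.coe_addRight, add_sub_cancel_right]
  ring_nf

/-- `subdivOp a` as a continuous linear map for the product topology on sequences. -/
def subdivOpL : (ℤ → ℂ) →L[ℂ] (ℤ → ℂ) :=
  ContinuousLinearMap.pi fun i =>
    ∑ j ∈ (hasFiniteSupport_coeff_sub a i).toFinset,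
      (a.coeff (i - 2 * j) : ℂ) • ContinuousLinearMap.proj j

theorem subdivOpL_apply (q : ℤ → ℂ) : subdivOpL a q = subdivOp a q := by
  ext i
  simp [subdivOpL, subdivOp_eq_sum]

end SubdivOp

theorem subdivData_shift (a : ℕ → ℝ[T;T⁻¹]) (q : ℤ → ℂ) (n : ℤ) (k : ℕ) :
    subdivData a (fun j => q (j - n)) k = fun i => subdivData a q k (i - 2 ^ k * n) := by
  induction k with
  | zero => simp [subdivData]
  | succ k ih =>
    ext i
    rw [subdivData, ih, subdivOp_shift, ← mul_assoc, ← pow_succ', subdivData]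

theorem polygon_shift (τ : ℕ → ℝ) (k : ℕ) (q : ℤ → ℂ) (n : ℤ) (x : ℝ) :
    polygon τ k (fun i => q (i - 2 ^ k * n)) x = polygon τ k q (x - n) := by
  have hu : (x - n - τ k) * 2 ^ k = (x - τ k) * 2 ^ k - (2 ^ k * n : ℤ) := by
    push_cast
    ring
  simp only [polygon, hu, Int.fract_sub_intCast, Int.floor_sub_intCast, sub_add_eq_add_sub]

/-- The `k`-th data of the scheme as a continuous linear map of the initial data. -/
def subdivDataL (a : ℕ → ℝ[T;T⁻¹]) : ℕ → (ℤ → ℂ) →L[ℂ] (ℤ → ℂ)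
  | 0 => .id ℂ _
  | k + 1 => (subdivOpL (a k)).comp (subdivDataL a k)

theorem subdivDataL_apply (a : ℕ → ℝ[T;T⁻¹]) (k : ℕ) (q : ℤ → ℂ) :
    subdivDataL a k q = subdivData a q k := by
  induction k with
  | zero => rfl
  | succ k ih =>
    rw [subdivDataL, ContinuousLinearMap.comp_apply, ih, subdivOpL_apply, subdivData]

/-- The value at `x` of the `k`-th polygon of the scheme as a continuous linear functional of the
initial data. -/
def polygonL (τ : ℕ → ℝ) (a : ℕ → ℝ[T;T⁻¹]) (k : ℕ) (x : ℝ) : (ℤ → ℂ) →L[ℂ] ℂ :=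
  let u : ℝ := (x - τ k) * 2 ^ k
  (((1 - Int.fract u : ℝ) : ℂ) • .proj ⌊u⌋ + ((Int.fract u : ℝ) : ℂ) • .proj (⌊u⌋ + 1) :
    (ℤ → ℂ) →L[ℂ] ℂ).comp (subdivDataL a k)

theorem polygonL_apply (τ : ℕ → ℝ) (a : ℕ → ℝ[T;T⁻¹]) (k : ℕ) (x : ℝ) (q : ℤ → ℂ) :
    polygonL τ a k x q = polygon τ k (subdivData a q k) x := by
  simp [polygonL, polygon, subdivDataL_apply]

/-! ### Polygons as sums of hat functions -/

/-- The hat function, supported on `[-1, 1]` with value `1` at `0`. -/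
def hat (x : ℝ) : ℂ := (max 0 (1 - |x|) : ℝ)

theorem continuous_hat : Continuous hat := by
  unfold hat
  fun_prop

theorem hat_eq_zero {x : ℝ} (hx : 1 ≤ |x|) : hat x = 0 := by
  simp [hat, hx]

theorem hasCompactSupport_hat : HasCompactSupport hat :=
  .intro (isCompact_closedBall 0 1) fun x hx => hat_eq_zero <| by
    simpa using (not_le.1 (mt mem_closedBall_zero_iff.2 hx)).le

theorem polygon_eq_semiConv_hat (τ : ℕ → ℝ) (k : ℕ) (q : ℤ → ℂ) (x : ℝ) :
    polygon τ k q x = semiConv q hat ((x - τ k) * 2 ^ k) := by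
  set u : ℝ := (x - τ k) * 2 ^ k
  have hfract := Int.self_sub_floor u
  have h0 := Int.fract_nonneg u
  have h1 := Int.fract_lt_one u
  have hleft : hat (u - ⌊u⌋) = (1 - Int.fract u : ℝ) := by
    rw [hat, hfract, abs_of_nonneg h0, max_eq_right (by linarith)]
  have hright : hat (u - (⌊u⌋ + 1 : ℤ)) = (Int.fract u : ℝ) := by
    rw [hat, Int.cast_add, Int.cast_one, ← sub_sub, hfract, abs_of_neg (by linarith),
      neg_sub, sub_sub_cancel, max_eq_right h0]
  have hout : ∀ j ∉ ({⌊u⌋, ⌊u⌋ + 1} : Finset ℤ), q j * hat (u - j) = 0 := by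
    intro j hj
    simp only [Finset.mem_insert, Finset.mem_singleton, not_or] at hj
    rw [hat_eq_zero, mul_zero]
    rcases lt_or_gt_of_ne hj.1 with hlt | hgt
    · have : (j : ℝ) + 1 ≤ ⌊u⌋ := by exact_mod_cast hlt
      exact le_abs.2 (.inl (by linarith))
    · have : (⌊u⌋ : ℝ) + 2 ≤ j := by exact_mod_cast (by omega : ⌊u⌋ + 2 ≤ j)
      exact le_abs.2 (.inr (by linarith))
  rw [semiConv, tsum_eq_sum hout, Finset.sum_pair (by omega), hleft, hright, polygon]
  ring

theorem continuous_polygon (τ : ℕ → ℝ) (k : ℕ) (q : ℤ → ℂ) : Continuous (polygon τ k q) := by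
  rw [funext (polygon_eq_semiConv_hat τ k q)]
  exact (continuous_semiConv continuous_hat hasCompactSupport_hat q).comp (by fun_prop)

/-! ### The basic limit function -/

/-- The `k`-th polygon of the scheme for the initial data `δ₀`. -/
def basicPolygon (τ : ℕ → ℝ) (a : ℕ → ℝ[T;T⁻¹]) (k : ℕ) : ℝ → ℂ :=
  polygon τ k (subdivData a (Pi.single 0 1) k)

section BasicLimit

variable {τ : ℕ → ℝ} {a : ℕ → ℝ[T;T⁻¹]}

theorem polygonL_single (k : ℕ) (x : ℝ) (j : ℤ) :
    polygonL τ a k x (Pi.single j 1) = basicPolygon τ a k (x - j) := by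
  have hshift : (Pi.single j 1 : ℤ → ℂ) = fun i => (Pi.single 0 1 : ℤ → ℂ) (i - j) := by
    ext i
    simp only [Pi.single_apply, sub_eq_zero]
  rw [polygonL_apply, hshift, subdivData_shift, polygon_shift, basicPolygon]

theorem polygon_subdivData_eq_semiConv (k : ℕ) (q : ℤ → ℂ) (x : ℝ) :
    polygon τ k (subdivData a q k) x = semiConv q (basicPolygon τ a k) x := by
  have hq : HasSum (fun j => q j • (Pi.single j 1 : ℤ → ℂ)) q := by
    refine Pi.hasSum.2 fun i => ?_
    convert hasSum_ite_eq i (q i) using 2 with j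
    rw [Pi.smul_apply, Pi.single_apply, smul_eq_mul, mul_ite, mul_one, mul_zero]
    grind
  have hsum := hq.mapL (polygonL τ a k x)
  simp only [map_smul, polygonL_single, smul_eq_mul] at hsum
  rw [← polygonL_apply]
  exact hsum.tsum_eq.symm

theorem exists_isCompact_forall_basicPolygon_eq_zero
    (hlim : ∀ q, ∃ g, IsLimitFunction τ a q g) :
    ∃ K, IsCompact K ∧ ∀ k, ∀ x ∉ K, basicPolygon τ a k x = 0 := by
  obtain ⟨s, hs⟩ := exists_finset_forall_eq_zero_of_bddAbove
    (ℓ := fun i : ℕ × Set.Icc (0 : ℝ) 1 => polygonL τ a i.1 i.2) fun q => by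
      obtain ⟨g, hg⟩ := hlim q
      simpa only [polygonL_apply] using bddAbove_range_norm_of_tendstoLocallyUniformly
        (fun k => continuous_polygon τ k _) hg isCompact_Icc
  refine ⟨⋃ j ∈ s, Set.Icc (-j : ℝ) (-j + 1), s.isCompact_biUnion fun j _ => isCompact_Icc,
    fun k x hx => ?_⟩
  have hfloor : -⌊x⌋ ∉ s := fun hmem => hx <| Set.mem_biUnion hmem <| by
    simpa using ⟨Int.floor_le x, (Int.lt_floor_add_one x).le⟩
  have hsingle := hs (k, ⟨Int.fract x, Int.fract_nonneg x, (Int.fract_lt_one x).le⟩)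
    (Pi.single (-⌊x⌋) 1) fun j hj =>
      Pi.single_eq_of_ne (ne_of_mem_of_not_mem hj hfloor) _
  rwa [polygonL_single, Int.cast_neg, sub_neg_eq_add, Int.fract_add_floor] at hsingle

theorem IsLimitFunction.continuous {q : ℤ → ℂ} {g : ℝ → ℂ} (hg : IsLimitFunction τ a q g) :
    Continuous g :=
  TendstoLocallyUniformly.continuous hg (.of_forall fun k => continuous_polygon τ k _)

theorem IsLimitFunction.tendsto_apply {q : ℤ → ℂ} {g : ℝ → ℂ} (hg : IsLimitFunction τ a q g)
    (x : ℝ) : Tendsto (fun k => polygon τ k (subdivData a q k) x) atTop (𝓝 (g x)) :=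
  (tendstoLocallyUniformlyOn_univ.2 hg).tendsto_at (Set.mem_univ x)

namespace Convergent

variable {φ : ℝ → ℂ} (hconv : Convergent τ a) (hφ : IsLimitFunction τ a (Pi.single 0 1) φ)
include hconv hφ

theorem exists_isCompact_forall_eq_zero :
    ∃ K, IsCompact K ∧ (∀ k, ∀ x ∉ K, basicPolygon τ a k x = 0) ∧ ∀ x ∉ K, φ x = 0 := by
  obtain ⟨K, hK, hzero⟩ := exists_isCompact_forall_basicPolygon_eq_zero hconv.1
  refine ⟨K, hK, hzero, fun x hx => tendsto_nhds_unique (hφ.tendsto_apply x) ?_⟩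
  exact tendsto_const_nhds.congr fun k => (hzero k x hx).symm

theorem hasCompactSupport : HasCompactSupport φ :=
  let ⟨_, hK, _, hzero⟩ := hconv.exists_isCompact_forall_eq_zero hφ
  .intro hK hzero

theorem eq_semiConv {q : ℤ → ℂ} {g : ℝ → ℂ} (hg : IsLimitFunction τ a q g) :
    g = semiConv q φ := by
  obtain ⟨K, hK, hzero, hzero'⟩ := hconv.exists_isCompact_forall_eq_zero hφ
  ext x
  obtain ⟨s, hs⟩ := exists_finset_forall_sub_notMem (isCompact_singleton (x := x)) hK
  have hsum : ∀ k, polygon τ k (subdivData a q k) x =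
      ∑ j ∈ s, q j * basicPolygon τ a k (x - j) := fun k => by
    rw [polygon_subdivData_eq_semiConv]
    exact tsum_eq_sum fun j hj => by rw [hzero k _ (hs x rfl j hj), mul_zero]
  have hlimit : Tendsto (fun k => ∑ j ∈ s, q j * basicPolygon τ a k (x - j)) atTop
      (𝓝 (∑ j ∈ s, q j * φ (x - j))) :=
    tendsto_finsetSum _ fun j _ => (hφ.tendsto_apply _).const_mul _
  rw [semiConv, tsum_eq_sum fun j hj => by rw [hzero' _ (hs x rfl j hj), mul_zero]]
  exact tendsto_nhds_unique (hg.tendsto_apply x) (by simpa only [hsum] using hlimit)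

theorem isLimitFunction_semiConv (q : ℤ → ℂ) : IsLimitFunction τ a q (semiConv q φ) := by
  obtain ⟨g, hg⟩ := hconv.1 q
  exact hconv.eq_semiConv hφ hg ▸ hg

theorem ne_zero : φ ≠ 0 := by
  rintro rfl
  obtain ⟨q, g, hg, hne⟩ := hconv.2
  refine hne ((hconv.eq_semiConv hφ hg).trans ?_)
  ext x
  simp [semiConv]

end Convergent

end BasicLimit

/-! ### Laplace transforms of the polygons -/

/-- The value at `e^{-Λ}` of a Laurent polynomial with real coefficients. -/
def symbolEval (a : ℝ[T;T⁻¹]) (Λ : ℂ) : ℂ :=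
  LaurentPolynomial.eval₂ Complex.ofRealHom (Units.mk0 (Complex.exp (-Λ)) (Complex.exp_ne_zero _)) a

theorem symbolEval_mul (a b : ℝ[T;T⁻¹]) (Λ : ℂ) :
    symbolEval (a * b) Λ = symbolEval a Λ * symbolEval b Λ := map_mul _ _ _

theorem symbolEval_C_mul_T (r : ℝ) (n : ℤ) (Λ : ℂ) :
    symbolEval (LaurentPolynomial.C r * T n) Λ = r * Complex.exp (-(Λ * n)) := by
  rw [symbolEval, LaurentPolynomial.eval₂_C_mul_T, Units.val_zpow_eq_zpow_val, Units.val_mk0,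
    ← Complex.exp_int_mul, mul_neg, mul_comm Λ, Complex.ofRealHom_eq_coe]

theorem differentiable_symbolEval (a : ℝ[T;T⁻¹]) : Differentiable ℂ (symbolEval a) := by
  induction a using LaurentPolynomial.induction_on' with
  | add p q hp hq =>
    rw [show symbolEval (p + q) = fun Λ => symbolEval p Λ + symbolEval q Λ from
      funext fun Λ => map_add _ _ _]
    exact hp.add hq
  | C_mul_T n r =>
    rw [funext (symbolEval_C_mul_T r n)]
    fun_prop

theorem hasSum_coeff_mul_exp (a : ℝ[T;T⁻¹]) (Λ : ℂ) :
    HasSum (fun i : ℤ => (a.coeff i : ℂ) * Complex.exp (-(Λ * i))) (symbolEval a Λ) := by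
  induction a using LaurentPolynomial.induction_on' with
  | add p q hp hq =>
    simpa [symbolEval, add_mul] using hp.add hq
  | C_mul_T n r =>
    rw [symbolEval_C_mul_T, ← LaurentPolynomial.single_eq_C_mul_T]
    convert hasSum_ite_eq n ((r : ℂ) * Complex.exp (-(Λ * n))) using 2 with i
    rw [AddMonoidAlgebra.coeff_single, Finsupp.single_apply]
    rcases eq_or_ne i n with rfl | hi
    · rw [if_pos rfl, if_pos rfl]
    · rw [if_neg hi, if_neg hi.symm, Complex.ofReal_zero, zero_mul]

theorem hasSum_subdivOp_mul_exp (a : ℝ[T;T⁻¹]) {d : ℤ → ℂ} (hd : d.support.Finite) (Λ : ℂ) :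
    HasSum (fun i : ℤ => subdivOp a d i * Complex.exp (-(Λ * i)))
      (symbolEval a Λ * ∑' j : ℤ, d j * Complex.exp (-(2 * Λ * j))) := by
  have hterm : ∀ j : ℤ, HasSum
      (fun i : ℤ => (a.coeff (i - 2 * j) : ℂ) * d j * Complex.exp (-(Λ * i)))
      (symbolEval a Λ * (d j * Complex.exp (-(2 * Λ * j)))) := by
    intro j
    rw [← (Equiv.addRight (2 * j)).hasSum_iff]
    refine ((hasSum_coeff_mul_exp a Λ).mul_right _).congr_fun fun i => ?_
    rw [Function.comp_apply, Equiv.coe_addRight, add_sub_cancel_right,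
      mul_mul_mul_comm, ← Complex.exp_add, mul_assoc]
    push_cast
    ring_nf
  have hzero : ∀ j ∉ hd.toFinset, d j = 0 := by simp
  rw [tsum_eq_sum fun j hj => by rw [hzero j hj, zero_mul], Finset.mul_sum]
  convert hasSum_sum fun j (_ : j ∈ hd.toFinset) => hterm j using 2 with i
  rw [← Finset.sum_mul, subdivOp, finsum_eq_sum_of_support_subset]
  exact (Function.support_mul_subset_right _ _).trans (by simp)

theorem finite_support_subdivOp (a : ℝ[T;T⁻¹]) {d : ℤ → ℂ} (hd : d.support.Finite) :
    (subdivOp a d).support.Finite := by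
  refine ((a.coeff.support.finite_toSet.prod hd).image fun x => x.1 + 2 * x.2).subset
    fun i hi => ?_
  obtain ⟨j, hj⟩ : ∃ j, (a.coeff (i - 2 * j) : ℂ) * d j ≠ 0 := by
    by_contra! hzero
    exact hi ((finsum_congr hzero).trans finsum_zero)
  exact ⟨(i - 2 * j, j), by simpa using hj, by simp⟩

theorem finite_support_subdivData (a : ℕ → ℝ[T;T⁻¹]) {d : ℤ → ℂ} (hd : d.support.Finite)
    (k : ℕ) : (subdivData a d k).support.Finite := by
  induction k with
  | zero => exact hd
  | succ k ih => exact finite_support_subdivOp (a k) ih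

theorem tsum_subdivData_mul_exp (a : ℕ → ℝ[T;T⁻¹]) {d : ℤ → ℂ} (hd : d.support.Finite) (k : ℕ)
    (Λ : ℂ) : ∑' i : ℤ, subdivData a d k i * Complex.exp (-(Λ / 2 ^ k * i)) =
      (∏ j ∈ Finset.range k, symbolEval (a j) (Λ / 2 ^ (j + 1))) *
        ∑' i : ℤ, d i * Complex.exp (-(Λ * i)) := by
  induction k with
  | zero => simp [subdivData]
  | succ k ih =>
    have hΛ : 2 * (Λ / 2 ^ (k + 1)) = Λ / 2 ^ k := by
      field_simp
      ring
    rw [subdivData, (hasSum_subdivOp_mul_exp (a k) (finite_support_subdivData a hd k) _).tsum_eq,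
      hΛ, ih, Finset.prod_range_succ]
    ring

theorem laplace_semiConv {φ : ℝ → ℂ} (hφ : Continuous φ) (hc : HasCompactSupport φ)
    {d : ℤ → ℂ} (hd : d.support.Finite) (Λ : ℂ) :
    laplace (semiConv d φ) Λ = (∑' i : ℤ, d i * Complex.exp (-(Λ * i))) * laplace φ Λ := by
  have hzero : ∀ j ∉ hd.toFinset, d j = 0 := by simp
  have hsum : semiConv d φ = fun x => ∑ j ∈ hd.toFinset, d j * φ (x - j) :=
    funext fun x => tsum_eq_sum fun j hj => by rw [hzero j hj, zero_mul]
  rw [hsum, laplace_sum_mul _ _ (ψ := fun (j : ℤ) x => φ (x - j)) (fun j => by fun_prop)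
    (fun j => hc.comp_homeomorph (Homeomorph.subRight (j : ℝ))),
    tsum_eq_sum fun j hj => by rw [hzero j hj, zero_mul], Finset.sum_mul]
  refine Finset.sum_congr rfl fun j _ => ?_
  have hshift := laplace_comp_sub φ j Λ
  push_cast at hshift
  rw [hshift, mul_assoc]

theorem laplace_hat_zero_ne_zero : laplace hat 0 ≠ 0 := by
  let h : C(ℝ, ℝ) := ⟨fun x => max 0 (1 - |x|), by fun_prop⟩
  have hc : HasCompactSupport h :=
    hasCompactSupport_hat.comp_left (g := Complex.re) rfl
  have hpos : 0 < ∫ x, h x :=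
    h.continuous.integral_pos_of_hasCompactSupport_nonneg_nonzero hc
      (fun x => le_max_left _ _) (x := 0) (by simp [h])
  have heq : laplace hat 0 = (∫ x, h x : ℝ) := by
    rw [← integral_complex_ofReal]
    simp [laplace, hat, h]
  exact heq ▸ Complex.ofReal_ne_zero.2 hpos.ne'

/-- The factor by which the transform of the `k`-th polygon differs from the product of the
symbols: it accounts for the shift by `τ k`, the dilation by `2 ^ k` and the hat function. -/
def polygonFactor (τ : ℕ → ℝ) (k : ℕ) (Λ : ℂ) : ℂ :=
  Complex.exp (-(Λ * τ k)) * ((2 ^ k)⁻¹ * laplace hat (Λ / 2 ^ k))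

theorem laplace_basicPolygon (τ : ℕ → ℝ) (a : ℕ → ℝ[T;T⁻¹]) (k : ℕ) (Λ : ℂ) :
    laplace (basicPolygon τ a k) Λ =
      polygonFactor τ k Λ * ∏ j ∈ Finset.range k, symbolEval (a j) (Λ / 2 ^ (j + 1)) := by
  have hδ : (Pi.single 0 1 : ℤ → ℂ).support.Finite :=
    (Set.finite_singleton 0).subset (Pi.support_single_subset)
  have hδsum : ∑' i : ℤ, (Pi.single 0 1 : ℤ → ℂ) i * Complex.exp (-(Λ * i)) = 1 := by
    rw [tsum_eq_single 0 fun i hi => by simp [hi]]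
    simp
  have hpoly : basicPolygon τ a k = fun x =>
      semiConv (subdivData a (Pi.single 0 1) k) hat ((x - τ k) * 2 ^ k) :=
    funext (polygon_eq_semiConv_hat τ k _)
  rw [hpoly, laplace_comp_sub (fun y => semiConv _ hat (y * 2 ^ k)),
    laplace_comp_mul _ (by positivity), Complex.ofReal_pow, Complex.ofReal_ofNat,
    laplace_semiConv continuous_hat hasCompactSupport_hat (finite_support_subdivData a hδ k),
    tsum_subdivData_mul_exp a hδ, hδsum, polygonFactor]
  ring

theorem differentiable_polygonFactor (τ : ℕ → ℝ) (k : ℕ) :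
    Differentiable ℂ (polygonFactor τ k) := by
  have := differentiable_laplace continuous_hat hasCompactSupport_hat
  unfold polygonFactor
  fun_prop

theorem eventually_polygonFactor_ne_zero (τ : ℕ → ℝ) {K : Set ℂ} (hK : IsCompact K) :
    ∀ᶠ k in atTop, ∀ z ∈ K, polygonFactor τ k z ≠ 0 := by
  have hcont := (differentiable_laplace continuous_hat hasCompactSupport_hat).continuous
  have hnear : ∀ᶠ z in 𝓝 (0 : ℂ), laplace hat z ≠ 0 :=
    hcont.continuousAt.eventually_ne laplace_hat_zero_ne_zero
  obtain ⟨r, hr, hball⟩ := Metric.eventually_nhds_iff.1 hnear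
  obtain ⟨C, hC⟩ := hK.isBounded.exists_norm_le
  have hlarge : ∀ᶠ k : ℕ in atTop, C / r < 2 ^ k :=
    (tendsto_pow_atTop_atTop_of_one_lt one_lt_two).eventually_gt_atTop _
  filter_upwards [hlarge] with k hk z hz
  refine mul_ne_zero (Complex.exp_ne_zero _) (mul_ne_zero (by simp) (hball ?_))
  rw [dist_zero_right, norm_div, norm_pow, Complex.norm_ofNat, div_lt_iff₀ (by positivity)]
  exact (hC z hz).trans_lt (by rwa [mul_comm, ← div_lt_iff₀ hr])

theorem differentiable_symbolEval_div (p : ℝ[T;T⁻¹]) (w : ℂ) :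
    Differentiable ℂ fun z => symbolEval p (z / w) :=
  (differentiable_symbolEval p).comp (differentiable_id.div_const w)

theorem differentiable_prod_symbolEval_div (a : ℕ → ℝ[T;T⁻¹]) (s : Finset ℕ) :
    Differentiable ℂ fun z => ∏ j ∈ s, symbolEval (a j) (z / 2 ^ (j + 1)) :=
  Differentiable.fun_finsetProd fun j _ => differentiable_symbolEval_div (a j) _

namespace Convergent

variable {τ τ' : ℕ → ℝ} {a c : ℕ → ℝ[T;T⁻¹]} {φ ψ : ℝ → ℂ}

theorem tendstoLocallyUniformly_laplace_basicPolygon (hconv : Convergent τ a)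
    (hφ : IsLimitFunction τ a (Pi.single 0 1) φ) :
    TendstoLocallyUniformly (fun k => laplace (basicPolygon τ a k)) (laplace φ) atTop :=
  let ⟨_, hK, hzero, _⟩ := hconv.exists_isCompact_forall_eq_zero hφ
  tendstoLocallyUniformly_laplace hK (fun k => continuous_polygon τ k _) hzero hφ

theorem analyticOrderAt_laplace_le_of_dvd (ha : Convergent τ a)
    (hφ : IsLimitFunction τ a (Pi.single 0 1) φ) (hc : Convergent τ' c)
    (hψ : IsLimitFunction τ' c (Pi.single 0 1) ψ) (hdvd : ∀ k, a k ∣ c k) (Λ : ℂ) :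
    analyticOrderAt (laplace φ) Λ ≤ analyticOrderAt (laplace ψ) Λ := by
  have hlimit_a := ha.tendstoLocallyUniformly_laplace_basicPolygon hφ
  have hlimit_c := hc.tendstoLocallyUniformly_laplace_basicPolygon hψ
  simp only [funext (laplace_basicPolygon _ _ _)] at hlimit_a hlimit_c
  obtain ⟨k, hk⟩ := exists_analyticOrderAt_le_prod
    (fun j => differentiable_symbolEval_div (a j) (2 ^ (j + 1))) (differentiable_polygonFactor τ)
    (laplace_ne_zero hφ.continuous (ha.hasCompactSupport hφ) (ha.ne_zero hφ)) hlimit_a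
    (fun K => eventually_polygonFactor_ne_zero τ) Λ
  refine hk.trans (ENat.forall_natCast_le_iff_le.1 fun n hn => ?_)
  refine le_analyticOrderAt_of_tendstoLocallyUniformly (fun K =>
    (differentiable_polygonFactor τ' K).fun_mul (differentiable_prod_symbolEval_div c _))
    hlimit_c ?_
  filter_upwards [eventually_ge_atTop k] with K hK
  choose b hb using hdvd
  have hsplit : ∀ z, polygonFactor τ' K z *
        ∏ j ∈ Finset.range K, symbolEval (c j) (z / 2 ^ (j + 1)) =
      (∏ j ∈ Finset.range k, symbolEval (a j) (z / 2 ^ (j + 1))) *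
        ((∏ j ∈ Finset.Ico k K, symbolEval (a j) (z / 2 ^ (j + 1))) * (polygonFactor τ' K z *
          ∏ j ∈ Finset.range K, symbolEval (b j) (z / 2 ^ (j + 1)))) := by
    intro z
    simp only [hb, symbolEval_mul, Finset.prod_mul_distrib]
    rw [← Finset.prod_range_mul_prod_Ico _ hK]
    ring
  rw [funext hsplit]
  exact hn.trans (analyticOrderAt_le_mul ((differentiable_prod_symbolEval_div a _).analyticAt Λ)
    (((differentiable_prod_symbolEval_div a _).mul ((differentiable_polygonFactor τ' K).mul
      (differentiable_prod_symbolEval_div b _))).analyticAt Λ))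

end Convergent

/-! ### Exponential polynomials as the kernel of a differential operator -/

/-- The space of smooth functions `ℝ → ℂ`, on which differentiation is a linear endomorphism. -/
def smoothSpace : Submodule ℂ (ℝ → ℂ) where
  carrier := {f | ContDiff ℝ (⊤ : ℕ∞) f}
  add_mem' hf hg := Set.mem_ofPred.2 (.add hf.out hg.out)
  zero_mem' := Set.mem_ofPred.2 contDiff_zero_fun
  smul_mem' c _ hf := Set.mem_ofPred.2 (.const_smul c hf.out)

theorem contDiff_of_mem_smoothSpace (f : smoothSpace) : ContDiff ℝ (⊤ : ℕ∞) (f : ℝ → ℂ) := f.2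

theorem differentiable_of_mem_smoothSpace (f : smoothSpace) : Differentiable ℝ (f : ℝ → ℂ) :=
  (contDiff_infty_iff_deriv.1 f.2).1

/-- Differentiation of smooth functions, the `D` of `P(D)`. -/
def diffOp : Module.End ℂ smoothSpace where
  toFun f := ⟨deriv f, (contDiff_infty_iff_deriv.1 f.2).2⟩
  map_add' f g := Subtype.ext <| funext fun x =>
    deriv_add (differentiable_of_mem_smoothSpace f x) (differentiable_of_mem_smoothSpace g x)
  map_smul' c f := Subtype.ext <| funext fun x =>
    deriv_const_smul c (differentiable_of_mem_smoothSpace f x)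

theorem coe_diffOp_pow (n : ℕ) (f : smoothSpace) :
    ((diffOp ^ n) f : ℝ → ℂ) = iteratedDeriv n f := by
  induction n with
  | zero => rw [pow_zero, Module.End.one_apply, iteratedDeriv_zero]
  | succ n ih =>
    rw [pow_succ', Module.End.mul_apply, iteratedDeriv_succ, ← ih]
    rfl

section expPolySpace

variable {T : ℕ} {γ : Fin (T + 1) → ℂ} {f : ℝ → ℂ}

theorem charPoly_ne_zero (hγ : γ (Fin.last T) ≠ 0) : charPoly γ ≠ 0 := by
  have hcoeff : (charPoly γ).coeff (Fin.last T) = γ (Fin.last T) := by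
    simp [charPoly, finsetSum_coeff, coeff_X_pow, Fin.val_inj, -Fin.val_last]
  intro h
  rw [h, coeff_zero] at hcoeff
  exact hγ hcoeff.symm

theorem coe_aeval_diffOp_charPoly (γ : Fin (T + 1) → ℂ) (f : smoothSpace) (x : ℝ) :
    (aeval diffOp (charPoly γ) f : ℝ → ℂ) x =
      ∑ j : Fin (T + 1), γ j * iteratedDeriv (j : ℕ) (f : ℝ → ℂ) x := by
  simp only [charPoly, map_sum, map_mul, aeval_C, map_pow, aeval_X, LinearMap.sum_apply,
    Submodule.coe_sum, Finset.sum_apply, Module.End.mul_apply, Module.algebraMap_end_apply,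
    Submodule.coe_smul, Pi.smul_apply, smul_eq_mul, coe_diffOp_pow]

theorem iteratedDeriv_eq_of_mem_expPolySpace (hγ : γ (Fin.last T) ≠ 0)
    (hf : f ∈ expPolySpace T γ) : iteratedDeriv T f = fun x =>
      -(γ (Fin.last T))⁻¹ * ∑ j : Fin T, γ j.castSucc * iteratedDeriv (j : ℕ) f x := by
  ext x
  have h := hf.2 x
  rw [Fin.sum_univ_castSucc] at h
  simp only [Fin.val_castSucc, Fin.val_last] at h
  field_simp
  linear_combination h

/-- The equation expresses the top derivative through lower ones, so smoothness bootstraps. -/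
theorem contDiff_infty_of_mem_expPolySpace (hγ : γ (Fin.last T) ≠ 0)
    (hf : f ∈ expPolySpace T γ) : ContDiff ℝ (⊤ : ℕ∞) f := by
  suffices hnat : ∀ n : ℕ, ContDiff ℝ (T + n : ℕ) f from
    contDiff_infty.2 fun n => (hnat n).of_le (by exact_mod_cast Nat.le_add_left n T)
  intro n
  induction n with
  | zero => exact hf.1
  | succ n ih =>
    have htop : ContDiff ℝ (n + 1 : ℕ) (iteratedDeriv T f) := by
      rw [iteratedDeriv_eq_of_mem_expPolySpace hγ hf]
      refine contDiff_const.mul (ContDiff.sum fun j _ => contDiff_const.mul ?_)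
      rw [iteratedDeriv_eq_iterate]
      exact ContDiff.iterate_deriv' (n + 1) j (ih.of_le (by exact_mod_cast (by omega)))
    rw [← add_assoc, contDiff_nat_succ_iff_contDiff_one_iteratedDeriv]
    refine ⟨ih, ?_⟩
    have := ContDiff.iterate_deriv' 1 n (by rwa [add_comm 1 n])
    rwa [iteratedDeriv_eq_iterate, ← Function.iterate_add_apply, add_comm n T,
      ← iteratedDeriv_eq_iterate] at this

theorem expPolySpace_eq_map_ker (hγ : γ (Fin.last T) ≠ 0) :
    expPolySpace T γ =
      ((LinearMap.ker (aeval diffOp (charPoly γ))).map smoothSpace.subtype : Set (ℝ → ℂ)) := by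
  ext f
  constructor
  · intro hf
    refine ⟨⟨f, contDiff_infty_of_mem_expPolySpace hγ hf⟩, Subtype.ext <| funext fun x => ?_, rfl⟩
    exact (coe_aeval_diffOp_charPoly γ _ x).trans (hf.2 x)
  · rintro ⟨f, hf, rfl⟩
    refine ⟨(contDiff_of_mem_smoothSpace f).of_le (by exact_mod_cast le_top), fun x => ?_⟩
    rw [Submodule.subtype_apply, ← coe_aeval_diffOp_charPoly, LinearMap.mem_ker.1 hf]
    rfl

theorem comp_add_const_mem_expPolySpace (hf : f ∈ expPolySpace T γ) (c : ℝ) :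
    (fun x => f (x + c)) ∈ expPolySpace T γ := by
  refine ⟨hf.1.comp (contDiff_id.add contDiff_const), fun x => ?_⟩
  simp only [iteratedDeriv_comp_add_const]
  exact hf.2 (x + c)

end expPolySpace

/-- The function `x ↦ x ^ r * e^{θ x}`. -/
def expMonomial (r : ℕ) (θ : ℂ) : smoothSpace :=
  ⟨fun x => (x : ℂ) ^ r * Complex.exp (θ * x), by
    have h : ContDiff ℝ (⊤ : ℕ∞) fun x : ℝ => (x : ℂ) := Complex.ofRealCLM.contDiff
    exact (h.pow r).mul (Complex.contDiff_exp.comp (contDiff_const.mul h))⟩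

theorem expMonomial_apply (r : ℕ) (θ : ℂ) (x : ℝ) :
    (expMonomial r θ : ℝ → ℂ) x = (x : ℂ) ^ r * Complex.exp (θ * x) := rfl

theorem aeval_X_sub_C_diffOp (θ : ℂ) (f : smoothSpace) :
    aeval diffOp (X - Polynomial.C θ) f = diffOp f - θ • f := by
  rw [map_sub, aeval_X, aeval_C, LinearMap.sub_apply, Module.algebraMap_end_apply]

theorem aeval_X_sub_C_expMonomial (r : ℕ) (θ η : ℂ) :
    aeval diffOp (X - Polynomial.C θ) (expMonomial r η) =
      (η - θ) • expMonomial r η + (r : ℂ) • expMonomial (r - 1) η := by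
  have hderiv : diffOp (expMonomial r η) =
      η • expMonomial r η + (r : ℂ) • expMonomial (r - 1) η := by
    ext x
    have hcast : HasDerivAt (fun x : ℝ => (x : ℂ)) 1 x := Complex.ofRealCLM.hasDerivAt
    refine ((hcast.pow r).mul ((hcast.const_mul η).cexp)).deriv.trans ?_
    simp only [Submodule.coe_add, Submodule.coe_smul, Pi.add_apply, Pi.smul_apply, smul_eq_mul,
      expMonomial_apply, Pi.pow_apply]
    ring
  rw [aeval_X_sub_C_diffOp, hderiv]
  module

theorem aeval_expMonomial_eq_zero {P : ℂ[X]} {r : ℕ} {θ : ℂ}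
    (h : (X - Polynomial.C θ) ^ (r + 1) ∣ P) : aeval diffOp P (expMonomial r θ) = 0 := by
  obtain ⟨Q, rfl⟩ := h
  rw [mul_comm, map_mul, Module.End.mul_apply]
  suffices aeval diffOp ((X - Polynomial.C θ) ^ (r + 1)) (expMonomial r θ) = 0 by
    rw [this, map_zero]
  induction r with
  | zero => rw [zero_add, pow_one, aeval_X_sub_C_expMonomial]; simp
  | succ r ih =>
    rw [pow_succ, map_mul, Module.End.mul_apply, aeval_X_sub_C_expMonomial]
    simp only [sub_self, zero_smul, zero_add, map_smul, Nat.add_sub_cancel]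
    rw [ih, smul_zero]

/-- The functions `x ^ r * e^{θ x}` with `r` smaller than the multiplicity of the root `θ` of
`P`. -/
def expMonomials (P : ℂ[X]) : Set smoothSpace :=
  {f | ∃ (r : ℕ) (θ : ℂ), (X - Polynomial.C θ) ^ (r + 1) ∣ P ∧ f = expMonomial r θ}

theorem exists_aeval_X_sub_C_eq_expMonomial {P : ℂ[X]} (θ : ℂ) {r : ℕ} {η : ℂ}
    (hd : (X - Polynomial.C η) ^ (r + 1) ∣ P) :
    ∃ v ∈ Submodule.span ℂ (expMonomials ((X - Polynomial.C θ) * P)),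
      aeval diffOp (X - Polynomial.C θ) v = expMonomial r η := by
  rcases eq_or_ne η θ with rfl | hη
  · refine ⟨((r + 1 : ℕ) : ℂ)⁻¹ • expMonomial (r + 1) η, Submodule.smul_mem _ _
      (Submodule.subset_span ⟨r + 1, η, ?_, rfl⟩), ?_⟩
    · rw [pow_succ' _ (r + 1)]
      exact mul_dvd_mul_left _ hd
    · rw [map_smul, aeval_X_sub_C_expMonomial, sub_self, zero_smul, zero_add, smul_smul,
        inv_mul_cancel₀ (Nat.cast_ne_zero.2 r.succ_ne_zero), one_smul, Nat.add_sub_cancel]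
  have hmem : ∀ {r}, (X - Polynomial.C η) ^ (r + 1) ∣ P →
      expMonomial r η ∈ Submodule.span ℂ (expMonomials ((X - Polynomial.C θ) * P)) :=
    fun hd => Submodule.subset_span ⟨_, η, hd.mul_left _, rfl⟩
  induction r with
  | zero =>
    refine ⟨(η - θ)⁻¹ • expMonomial 0 η, Submodule.smul_mem _ _ (hmem hd), ?_⟩
    rw [map_smul, aeval_X_sub_C_expMonomial, Nat.cast_zero, zero_smul, add_zero,
      inv_smul_smul₀ (sub_ne_zero.2 hη)]
  | succ r ih =>
    obtain ⟨v, hv, hv_eq⟩ := ih ((pow_dvd_pow _ (Nat.le_succ _)).trans hd)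
    refine ⟨(η - θ)⁻¹ • (expMonomial (r + 1) η - ((r + 1 : ℕ) : ℂ) • v),
      Submodule.smul_mem _ _ (Submodule.sub_mem _ (hmem hd) (Submodule.smul_mem _ _ hv)), ?_⟩
    rw [map_smul, map_sub, map_smul, hv_eq, aeval_X_sub_C_expMonomial, Nat.add_sub_cancel,
      add_sub_cancel_right, inv_smul_smul₀ (sub_ne_zero.2 hη)]

theorem span_expMonomials_le_map (P : ℂ[X]) (θ : ℂ) :
    Submodule.span ℂ (expMonomials P) ≤
      (Submodule.span ℂ (expMonomials ((X - Polynomial.C θ) * P))).map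
        (aeval diffOp (X - Polynomial.C θ)) := by
  rw [Submodule.span_le]
  rintro _ ⟨r, η, hd, rfl⟩
  exact exists_aeval_X_sub_C_eq_expMonomial θ hd

theorem eq_smul_expMonomial_of_aeval_X_sub_C_eq_zero {θ : ℂ} {w : smoothSpace}
    (hw : aeval diffOp (X - Polynomial.C θ) w = 0) :
    w = (w : ℝ → ℂ) 0 • expMonomial 0 θ := by
  have hderiv : ∀ x : ℝ,
      HasDerivAt (fun x : ℝ => (w : ℝ → ℂ) x * Complex.exp (-θ * x)) 0 x := by
    intro x
    have hcast : HasDerivAt (fun x : ℝ => (x : ℂ)) 1 x := Complex.ofRealCLM.hasDerivAt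
    have hw_deriv : deriv (w : ℝ → ℂ) x = θ * (w : ℝ → ℂ) x :=
      congrFun (congrArg Subtype.val (sub_eq_zero.1 ((aeval_X_sub_C_diffOp θ w).symm.trans hw))) x
    convert! (differentiable_of_mem_smoothSpace w x).hasDerivAt.mul
      ((hcast.const_mul (-θ)).cexp) using 1
    rw [hw_deriv]
    ring
  ext x
  have hconst := is_const_of_deriv_eq_zero (fun x => (hderiv x).differentiableAt)
    (fun x => (hderiv x).deriv) x 0
  simp only [Complex.ofReal_zero, mul_zero, Complex.exp_zero, mul_one] at hconst
  rw [Submodule.coe_smul, Pi.smul_apply, smul_eq_mul, expMonomial_apply, pow_zero, one_mul,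
    ← hconst, mul_assoc, ← Complex.exp_add, neg_mul, neg_add_cancel, Complex.exp_zero, mul_one]

theorem ker_aeval_diffOp_eq_span {P : ℂ[X]} (hP : P ≠ 0) :
    LinearMap.ker (aeval diffOp P) = Submodule.span ℂ (expMonomials P) := by
  refine le_antisymm (fun f hf => ?_) (Submodule.span_le.2 ?_)
  · rw [LinearMap.mem_ker] at hf
    induction hn : P.natDegree generalizing P f with
    | zero =>
      rw [eq_C_of_natDegree_eq_zero hn, aeval_C, Module.algebraMap_end_apply, smul_eq_zero] at hf
      refine (hf.resolve_left fun h => hP ?_) ▸ Submodule.zero_mem _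
      rw [eq_C_of_natDegree_eq_zero hn, h, Polynomial.C_0]
    | succ n ih =>
      obtain ⟨θ, hθ⟩ := IsAlgClosed.exists_root P
        (natDegree_pos_iff_degree_pos.1 (hn ▸ n.succ_pos)).ne'
      obtain ⟨Q, rfl⟩ := dvd_iff_isRoot.2 hθ
      have hQ : Q ≠ 0 := right_ne_zero_of_mul hP
      rw [natDegree_mul (X_sub_C_ne_zero θ) hQ, natDegree_X_sub_C] at hn
      have hu : aeval diffOp Q (aeval diffOp (X - Polynomial.C θ) f) = 0 := by
        rw [← Module.End.mul_apply, ← map_mul, mul_comm, hf]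
      obtain ⟨v, hv, hv_eq⟩ := span_expMonomials_le_map Q θ (ih hQ _ hu (by omega))
      have hw := eq_smul_expMonomial_of_aeval_X_sub_C_eq_zero
        (show aeval diffOp (X - Polynomial.C θ) (f - v) = 0 by rw [map_sub, hv_eq, sub_self])
      rw [← sub_add_cancel f v, hw]
      exact Submodule.add_mem _
        (Submodule.smul_mem _ _ (Submodule.subset_span ⟨0, θ, by simp, rfl⟩)) hv
  · rintro _ ⟨r, θ, hd, rfl⟩
    exact aeval_expMonomial_eq_zero hd

theorem expPolySpace_eq_map_span {T : ℕ} {γ : Fin (T + 1) → ℂ} (hγ : γ (Fin.last T) ≠ 0) :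
    expPolySpace T γ = ((Submodule.span ℂ (expMonomials (charPoly γ))).map
      smoothSpace.subtype : Set (ℝ → ℂ)) := by
  rw [expPolySpace_eq_map_ker hγ, ker_aeval_diffOp_eq_span (charPoly_ne_zero hγ)]

section QuasiPeriodic

variable {Λ : ℂ} {f : smoothSpace}

theorem diffOp_pow_add_one (hf : ∀ x : ℝ, f.1 (x + 1) = Complex.exp Λ * f.1 x) (n : ℕ) (x : ℝ) :
    ((diffOp ^ n) f).1 (x + 1) = Complex.exp Λ * ((diffOp ^ n) f).1 x := by
  induction n generalizing x with
  | zero => exact hf x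
  | succ n ih =>
    rw [pow_succ', Module.End.mul_apply]
    change deriv _ _ = _ * deriv _ _
    rw [← deriv_comp_add_const, funext ih]
    exact deriv_const_mul_field _

theorem integral_exp_mul_diffOp (hf : ∀ x : ℝ, f.1 (x + 1) = Complex.exp Λ * f.1 x) :
    ∫ x in (0 : ℝ)..1, Complex.exp (-(Λ * x)) * (diffOp f).1 x =
      Λ * ∫ x in (0 : ℝ)..1, Complex.exp (-(Λ * x)) * f.1 x := by
  have hexp : ∀ x : ℝ, HasDerivAt (fun x : ℝ => Complex.exp (-(Λ * x)))
      (-Λ * Complex.exp (-(Λ * x))) x := by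
    intro x
    have hcast : HasDerivAt (fun x : ℝ => (x : ℂ)) 1 x := Complex.ofRealCLM.hasDerivAt
    convert! (hcast.const_mul Λ).fun_neg.cexp using 1
    ring
  have hcont := (contDiff_of_mem_smoothSpace (diffOp f)).continuous
  have hone : f.1 1 = Complex.exp Λ * f.1 0 := by simpa using hf 0
  have hparts := intervalIntegral.integral_mul_deriv_eq_deriv_mul (a := (0 : ℝ)) (b := 1)
    (fun x _ => hexp x) (fun x _ => (differentiable_of_mem_smoothSpace f x).hasDerivAt)
    ((by fun_prop : Continuous _).intervalIntegrable _ _) (hcont.intervalIntegrable _ _)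
  refine hparts.trans ?_
  rw [hone, ← mul_assoc, ← Complex.exp_add]
  simp only [mul_assoc, intervalIntegral.integral_const_mul]
  simp

theorem integral_exp_mul_aeval_diffOp (hf : ∀ x : ℝ, f.1 (x + 1) = Complex.exp Λ * f.1 x)
    (P : ℂ[X]) :
    ∫ x in (0 : ℝ)..1, Complex.exp (-(Λ * x)) * (aeval diffOp P f).1 x =
      P.eval Λ * ∫ x in (0 : ℝ)..1, Complex.exp (-(Λ * x)) * f.1 x := by
  have hint : ∀ g : smoothSpace, IntervalIntegrable (fun x : ℝ => Complex.exp (-(Λ * x)) * g.1 x)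
      MeasureTheory.volume 0 1 := fun g =>
    have hg := (contDiff_of_mem_smoothSpace g).continuous
    Continuous.intervalIntegrable (by fun_prop) _ _
  induction P using Polynomial.induction_on' with
  | add P Q hP hQ =>
    simp only [map_add, LinearMap.add_apply, Submodule.coe_add, Pi.add_apply, mul_add, eval_add,
      add_mul]
    rw [intervalIntegral.integral_add (hint _) (hint _), hP, hQ]
  | monomial n c =>
    have hpow : ∫ x in (0 : ℝ)..1, Complex.exp (-(Λ * x)) * ((diffOp ^ n) f).1 x =
        Λ ^ n * ∫ x in (0 : ℝ)..1, Complex.exp (-(Λ * x)) * f.1 x := by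
      induction n with
      | zero => rw [pow_zero, pow_zero, one_mul, Module.End.one_apply]
      | succ n ih =>
        rw [pow_succ', pow_succ', Module.End.mul_apply,
          integral_exp_mul_diffOp (diffOp_pow_add_one hf n), ih, mul_assoc]
    simp only [aeval_monomial, Module.End.mul_apply, Module.algebraMap_end_apply,
      Submodule.coe_smul, Pi.smul_apply, smul_eq_mul, eval_monomial, mul_left_comm _ c]
    rw [intervalIntegral.integral_const_mul, hpow, mul_assoc]

end QuasiPeriodic

theorem integral_exp_mul_eq_zero {T : ℕ} {γ : Fin (T + 1) → ℂ} (hγ : γ (Fin.last T) ≠ 0)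
    {f : ℝ → ℂ} (hf : f ∈ expPolySpace T γ) {Λ : ℂ}
    (hper : ∀ x, f (x + 1) = Complex.exp Λ * f x) (hΛ : ¬ (charPoly γ).IsRoot Λ) :
    ∫ x in (0 : ℝ)..1, Complex.exp (-(Λ * x)) * f x = 0 := by
  rw [expPolySpace_eq_map_ker hγ] at hf
  obtain ⟨f, hker, rfl⟩ := hf
  have h := integral_exp_mul_aeval_diffOp hper (charPoly γ)
  rw [LinearMap.mem_ker.1 hker] at h
  simpa [IsRoot.def.not.1 hΛ] using h.symm

/-! ### Strang–Fix conditions -/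

theorem exp_add_two_pi_I_mul (θ : ℂ) (m : ℤ) :
    Complex.exp (θ + 2 * Real.pi * Complex.I * m) = Complex.exp θ := by
  rw [mul_comm _ (m : ℂ), Complex.exp_periodic.int_mul]

theorem semiConv_exp_add_one (φ : ℝ → ℂ) (θ : ℂ) (x : ℝ) :
    semiConv (fun j => Complex.exp (θ * j)) φ (x + 1) =
      Complex.exp θ * semiConv (fun j => Complex.exp (θ * j)) φ x := by
  rw [semiConv, semiConv, ← tsum_mul_left, ← (Equiv.addRight (1 : ℤ)).tsum_eq]
  refine tsum_congr fun j => ?_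
  rw [Equiv.coe_addRight, Int.cast_add, Int.cast_one, mul_add, mul_one, Complex.exp_add,
    Int.cast_add, Int.cast_one, add_sub_add_right_eq_sub]
  ring

section Generation

variable {T : ℕ} {γ : Fin (T + 1) → ℂ} {φ : ℝ → ℂ} {θ : ℂ} {n : ℕ}

theorem not_isRoot_add_two_pi_I_mul
    (hsep : ∀ θ θ' : ℂ, (charPoly γ).IsRoot θ → (charPoly γ).IsRoot θ' →
      Complex.exp θ = Complex.exp θ' → θ = θ')
    (hθ : (charPoly γ).IsRoot θ) {m : ℤ} (hm : m ≠ 0) :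
    ¬ (charPoly γ).IsRoot (θ + 2 * Real.pi * Complex.I * m) := by
  intro h
  have hzero := hsep _ _ hθ h (exp_add_two_pi_I_mul θ m).symm
  rw [left_eq_add, mul_eq_zero, Int.cast_eq_zero] at hzero
  exact hzero.elim Complex.two_pi_I_ne_zero hm

theorem expMonomial_mem_expPolySpace (hγ : γ (Fin.last T) ≠ 0) {r : ℕ}
    (hdvd : (X - Polynomial.C θ) ^ (r + 1) ∣ charPoly γ) :
    (expMonomial r θ : ℝ → ℂ) ∈ expPolySpace T γ := by
  rw [expPolySpace_eq_map_ker hγ]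
  exact ⟨_, aeval_expMonomial_eq_zero hdvd, rfl⟩

theorem semiConv_exp_mem_expPolySpace (hγ : γ (Fin.last T) ≠ 0) (hφ : Continuous φ)
    (hc : HasCompactSupport φ)
    (hgen : ∀ f ∈ expPolySpace T γ, semiConv (fun j => f j) φ ∈ expPolySpace T γ)
    (hdvd : (X - Polynomial.C θ) ^ (n + 1) ∣ charPoly γ)
    (hzero : ∀ s < n, ∀ m : ℤ, m ≠ 0 →
      laplace (fun y => (-y) ^ s * φ y) (θ + 2 * Real.pi * Complex.I * m) = 0) :
    semiConv (fun j => Complex.exp (θ * j)) (fun y => (-y) ^ n * φ y) ∈ expPolySpace T γ := by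
  have hmem : ∀ r ≤ n, (expMonomial r θ : ℝ → ℂ) ∈ expPolySpace T γ := fun r hr =>
    expMonomial_mem_expPolySpace hγ ((pow_dvd_pow _ (Nat.succ_le_succ hr)).trans hdvd)
  have hmap := hgen _ (hmem n le_rfl)
  have hsum : semiConv (fun j => Complex.exp (θ * j)) (fun y => (-y) ^ n * φ y) =
      semiConv (fun j => (expMonomial n θ : ℝ → ℂ) j) φ - ∑ s ∈ Finset.range n,
        (n.choose s * laplace (fun y => (-y) ^ s * φ y) θ) •
          (expMonomial (n - s) θ : ℝ → ℂ) := by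
    ext x
    have hexpand := semiConv_pow_mul_exp hc n θ x
    rw [Finset.sum_range_succ, Nat.sub_self, Nat.choose_self, pow_zero, Nat.cast_one, one_mul,
      one_mul] at hexpand
    simp only [Pi.sub_apply, Finset.sum_apply, Pi.smul_apply, smul_eq_mul, expMonomial_apply,
      Complex.ofReal_intCast]
    rw [hexpand, add_comm, eq_sub_iff_add_eq, add_right_inj]
    refine Finset.sum_congr rfl fun s hs => ?_
    rw [semiConv_exp_eq_of_laplace_eq_zero (φ := fun y => (-y) ^ s * φ y) (by fun_prop) hc.mul_left
      (hzero s (Finset.mem_range.1 hs))]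
    ring
  rw [hsum]
  rw [expPolySpace_eq_map_ker hγ] at hmem hmap ⊢
  exact Submodule.sub_mem _ hmap (Submodule.sum_mem _ fun s _ =>
    Submodule.smul_mem _ _ (hmem _ (Nat.sub_le n s)))

/-- Modulo the terms already known to lie in the space, the image of `x ^ n * e^{θ x}` is
`semiConv` of `e^{θ j}`, whose Fourier coefficients over a period vanish away from the roots. -/
theorem le_analyticOrderAt_laplace_of_forall_semiConv_mem (hγ : γ (Fin.last T) ≠ 0)
    (hsep : ∀ θ θ' : ℂ, (charPoly γ).IsRoot θ → (charPoly γ).IsRoot θ' →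
      Complex.exp θ = Complex.exp θ' → θ = θ')
    (hφ : Continuous φ) (hc : HasCompactSupport φ)
    (hgen : ∀ f ∈ expPolySpace T γ, semiConv (fun j => f j) φ ∈ expPolySpace T γ)
    (hdvd : (X - Polynomial.C θ) ^ n ∣ charPoly γ) {m : ℤ} (hm : m ≠ 0) :
    n ≤ analyticOrderAt (laplace φ) (θ + 2 * Real.pi * Complex.I * m) := by
  induction n generalizing m with
  | zero => exact zero_le
  | succ n ih =>
    have hih := fun (m : ℤ) (hm : m ≠ 0) => ih ((pow_dvd_pow _ n.le_succ).trans hdvd) hm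
    simp only [le_analyticOrderAt_laplace_iff hφ hc, Nat.forall_lt_succ_right] at hih ⊢
    refine ⟨hih m hm, ?_⟩
    have hmem := semiConv_exp_mem_expPolySpace hγ hφ hc hgen hdvd fun s hs m hm => hih m hm s hs
    have hroot : (charPoly γ).IsRoot θ :=
      dvd_iff_isRoot.1 ((dvd_pow_self _ n.succ_ne_zero).trans hdvd)
    rw [← integral_exp_mul_semiConv_exp (φ := fun y => (-y) ^ n * φ y) (by fun_prop) hc.mul_left
      (exp_add_two_pi_I_mul θ m)]
    refine integral_exp_mul_eq_zero hγ hmem (fun x => ?_)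
      (not_isRoot_add_two_pi_I_mul hsep hroot hm)
    rw [exp_add_two_pi_I_mul, semiConv_exp_add_one]

end Generation

section Reproduction

variable {ψ : ℝ → ℂ} {c : ℝ}

theorem eq_of_forall_eval_add_intCast_eq {P Q : ℂ[X]} (c : ℂ)
    (h : ∀ i : ℤ, P.eval (c + i) = Q.eval (c + i)) : P = Q := by
  refine eq_of_infinite_eval_eq P Q ?_
  refine (Set.infinite_range_of_injective (f := fun i : ℤ => c + i) ?_).mono ?_
  · exact fun i j hij => Int.cast_injective (add_left_cancel hij)
  · rintro _ ⟨i, rfl⟩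
    exact h i

theorem semiConv_pow_mul_exp_eq (hψ : Continuous ψ) (hc : HasCompactSupport ψ)
    (hint : ∀ (q : ℤ → ℂ) (i : ℤ), semiConv q ψ (c + i) = q i) {r : ℕ} {θ : ℂ}
    (hzero : ∀ m : ℤ, m ≠ 0 →
      (r + 1 : ℕ) ≤ analyticOrderAt (laplace ψ) (θ + 2 * Real.pi * Complex.I * m)) (x : ℝ) :
    semiConv (fun j => j ^ r * Complex.exp (θ * j)) ψ x =
      (x - c) ^ r * Complex.exp (θ * (x - c)) := by
  simp only [le_analyticOrderAt_laplace_iff hψ hc] at hzero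
  let P : ℂ[X] := ∑ s ∈ Finset.range (r + 1),
    Polynomial.C (r.choose s * laplace (fun y => (-y) ^ s * ψ y) θ) * X ^ (r - s)
  have hP : ∀ x : ℝ, semiConv (fun j => j ^ r * Complex.exp (θ * j)) ψ x =
      P.eval (x : ℂ) * Complex.exp (θ * x) := by
    intro x
    rw [semiConv_pow_mul_exp hc, eval_finsetSum, Finset.sum_mul]
    refine Finset.sum_congr rfl fun s hs => ?_
    rw [semiConv_exp_eq_of_laplace_eq_zero (φ := fun y => (-y) ^ s * ψ y) (by fun_prop) hc.mul_left
      fun m hm => hzero m hm s (Finset.mem_range.1 hs)]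
    simp only [eval_mul, Polynomial.eval_C, eval_pow, eval_X]
    ring
  have hP_eq : P = Polynomial.C (Complex.exp (-(θ * c))) * (X - Polynomial.C (c : ℂ)) ^ r := by
    refine eq_of_forall_eval_add_intCast_eq (c : ℂ) fun i => ?_
    have hi := (hP (c + i)).symm.trans (hint _ i)
    push_cast at hi
    rw [← mul_left_inj' (Complex.exp_ne_zero (θ * (c + i))), hi]
    simp only [eval_mul, Polynomial.eval_C, eval_pow, eval_sub, eval_X, add_sub_cancel_left]
    rw [mul_right_comm, ← Complex.exp_add, mul_comm]
    congr 2
    ring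
  rw [hP, hP_eq]
  simp only [eval_mul, Polynomial.eval_C, eval_pow, eval_sub, eval_X]
  rw [mul_right_comm, ← Complex.exp_add, mul_comm]
  congr 2
  ring

/-- Convolution with a fixed compactly supported function, as a linear map on sequences. -/
def semiConvL (hc : HasCompactSupport ψ) : (ℤ → ℂ) →ₗ[ℂ] ℝ → ℂ where
  toFun q := semiConv q ψ
  map_add' q q' := funext fun x => by
    simpa only [semiConv, Pi.add_apply, add_mul] using
      (summable_mul_comp_sub hc q x).tsum_add (summable_mul_comp_sub hc q' x)
  map_smul' b q := funext fun x => by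
    simp only [semiConv, Pi.smul_apply, smul_eq_mul, mul_assoc, tsum_mul_left, RingHom.id_apply]

theorem semiConv_eq_of_mem_expPolySpace {T : ℕ} {γ : Fin (T + 1) → ℂ}
    (hγ : γ (Fin.last T) ≠ 0) (hψ : Continuous ψ) (hc : HasCompactSupport ψ)
    (hint : ∀ (q : ℤ → ℂ) (i : ℤ), semiConv q ψ (c + i) = q i)
    (hzero : ∀ (n : ℕ) (θ : ℂ), (X - Polynomial.C θ) ^ n ∣ charPoly γ → ∀ m : ℤ, m ≠ 0 →
      n ≤ analyticOrderAt (laplace ψ) (θ + 2 * Real.pi * Complex.I * m))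
    {f : ℝ → ℂ} (hf : f ∈ expPolySpace T γ) : semiConv (fun j => f (c + j)) ψ = f := by
  suffices h : ∀ g ∈ Submodule.span ℂ (expMonomials (charPoly γ)),
      semiConv (fun j => (g : ℝ → ℂ) j) ψ = fun x => (g : ℝ → ℂ) (x - c) by
    have hg := comp_add_const_mem_expPolySpace hf c
    rw [expPolySpace_eq_map_span hγ] at hg
    obtain ⟨g, hg, hgf⟩ := hg
    have hval : ∀ x, (g : ℝ → ℂ) x = f (x + c) := congrFun hgf
    simpa only [hval, sub_add_cancel, add_comm _ c, add_sub_cancel] using h g hg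
  intro g hg
  let samples : smoothSpace →ₗ[ℂ] ℤ → ℂ :=
    LinearMap.funLeft ℂ ℂ (fun j : ℤ => (j : ℝ)) ∘ₗ smoothSpace.subtype
  let translate : smoothSpace →ₗ[ℂ] ℝ → ℂ :=
    LinearMap.funLeft ℂ ℂ (fun x : ℝ => x - c) ∘ₗ smoothSpace.subtype
  suffices Set.EqOn (semiConvL hc ∘ₗ samples) translate (expMonomials (charPoly γ)) from
    LinearMap.eqOn_span this hg
  rintro _ ⟨r, θ, hdvd, rfl⟩
  ext x
  change semiConv (fun j => (expMonomial r θ).1 j) ψ x = (expMonomial r θ).1 (x - c)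
  simpa only [expMonomial_apply, Complex.ofReal_intCast, Complex.ofReal_sub] using
    semiConv_pow_mul_exp_eq hψ hc hint (hzero _ θ hdvd) x

end Reproduction

/-! ### The Bezout polynomials -/

section Bezout

variable {K : Type*} [Field K] {a b f : K[X]}

theorem eq_of_mul_add_mul_eq {u u' v v' : K[X]} (hab : IsCoprime a b) (hu : u.degree < b.degree)
    (hu' : u'.degree < b.degree) (h : a * u + b * v = a * u' + b * v') : u = u' := by
  have hdvd : b ∣ a * (u - u') := ⟨v' - v, by linear_combination h⟩
  exact sub_eq_zero.1 (eq_zero_of_dvd_of_degree_lt (hab.symm.dvd_of_dvd_mul_left hdvd)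
    ((degree_sub_le _ _).trans_lt (max_lt hu hu')))

theorem exists_mul_add_mul_eq_of_degree_lt (hab : IsCoprime a b)
    (hf : f.degree < a.degree + b.degree) :
    ∃ u v : K[X], u.degree < b.degree ∧ v.degree < a.degree ∧ a * u + b * v = f := by
  have hne : a.degree + b.degree ≠ ⊥ := hf.ne_bot
  rw [WithBot.add_ne_bot, degree_ne_bot, degree_ne_bot] at hne
  obtain ⟨x, y, hxy⟩ := hab
  set u := (f * x) % b
  set v := f * y + a * ((f * x) / b)
  have huv : a * u + b * v = f := by
    linear_combination a * EuclideanDomain.div_add_mod (f * x) b + f * hxy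
  have hu : u.degree < b.degree := degree_mod_lt _ hne.2
  refine ⟨u, v, hu, lt_of_not_ge fun hv => ?_, huv⟩
  have hau : (a * u).degree < a.degree + b.degree := by
    rw [degree_mul]
    exact WithBot.add_lt_add_left (degree_ne_bot.2 hne.1) hu
  have hbv : (b * v).degree < a.degree + b.degree := by
    rw [eq_sub_of_add_eq' huv]
    exact (degree_sub_le _ _).trans_lt (max_lt hf hau)
  rw [degree_mul, add_comm] at hbv
  exact hbv.not_ge (add_le_add_left hv _)

end Bezout

namespace Star

variable (s : Star)

theorem sign_mul_self : s.sign * s.sign = 1 := by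
  cases s <;> simp [sign]

theorem one_le_ell : 1 ≤ s.ell := by
  cases s <;> simp [ell]

theorem ell_le_two : s.ell ≤ 2 := by
  cases s <;> simp [ell]

theorem sign_mul_neg_one_pow {i : ℕ} (hi : 1 ≤ i) : s.sign * (-1) ^ (2 * i - s.ell) = 1 := by
  obtain ⟨i, rfl⟩ := Nat.exists_eq_add_of_le' hi
  cases s
  · simp [sign, ell, mul_add]
  · simp [sign, ell, mul_add, pow_succ]

end Star

theorem coeff_negArg (a : ℝ[X]) (l : ℕ) : (negArg a).coeff l = (-1) ^ l * a.coeff l := by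
  rw [negArg, ← neg_one_mul (X : ℝ[X]), ← Polynomial.C_1, ← Polynomial.C_neg, comp_C_mul_X_coeff,
    mul_comm]

theorem negArg_two_mul_X_pow (e : ℕ) :
    negArg (2 * X ^ e) = Polynomial.C ((-1) ^ e) * (2 * X ^ e) := by
  simp only [negArg, mul_comp, pow_comp, X_comp, ofNat_comp, map_pow, map_neg, map_one,
    neg_pow (X : ℝ[X]) e]
  ring

theorem negArg_eq_of_mul_add_mul_eq {a u v : ℝ[X]} (ha : IsCoprime a (negArg a)) {s : Star} {i : ℕ}
    (hi : 1 ≤ i) (hu : u.degree < a.degree) (hv : v.degree < a.degree)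
    (huv : a * u + negArg a * v = 2 * X ^ (2 * i - s.ell)) :
    negArg u = Polynomial.C s.sign * v := by
  have hsign : Polynomial.C s.sign * Polynomial.C ((-1) ^ (2 * i - s.ell)) = (1 : ℝ[X]) := by
    rw [← Polynomial.C_mul, s.sign_mul_neg_one_pow hi, Polynomial.C_1]
  have hneg : negArg a * negArg u + a * negArg v =
      Polynomial.C ((-1) ^ (2 * i - s.ell)) * (2 * X ^ (2 * i - s.ell)) := by
    rw [← negArg_two_mul_X_pow, ← huv]
    simp only [negArg, add_comp, mul_comp_neg_X, comp_neg_X_comp_neg_X]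
  have hswap : Polynomial.C s.sign * negArg v = u := by
    refine eq_of_mul_add_mul_eq (v := Polynomial.C s.sign * negArg u) (v' := v) ha ?_ ?_ ?_
    · rw [degree_C_mul (left_ne_zero_of_mul_eq_one s.sign_mul_self), negArg, negArg,
        degree_comp_neg_X, degree_comp_neg_X]
      exact hv
    · rwa [negArg, degree_comp_neg_X]
    · rw [huv]
      linear_combination Polynomial.C s.sign * hneg + 2 * X ^ (2 * i - s.ell) * hsign
  rw [← hswap, negArg, mul_comp_neg_X, C_comp, negArg, comp_neg_X_comp_neg_X]

theorem existsUnique_isBezoutPoly {a : ℝ[X]} (ha : IsCoprime a (negArg a)) (s : Star) {i : ℕ}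
    (hi : 1 ≤ i) (hin : i ≤ a.natDegree) : ∃! p, IsBezoutPoly a s i p := by
  have hdeg : a.degree = a.natDegree := degree_eq_natDegree (ne_zero_of_natDegree_gt (hi.trans hin))
  have hdeg' : (negArg a).degree = a.natDegree := degree_comp_neg_X.trans hdeg
  have hlt : (2 * X ^ (2 * i - s.ell) : ℝ[X]).degree < a.degree + (negArg a).degree := by
    rw [← Polynomial.C_ofNat, degree_C_mul_X_pow _ two_ne_zero, hdeg, hdeg', ← Nat.cast_add,
      Nat.cast_lt]
    have := s.one_le_ell
    omega
  obtain ⟨u, v, hu, hv, huv⟩ := exists_mul_add_mul_eq_of_degree_lt ha hlt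
  have hsign : Polynomial.C s.sign * Polynomial.C s.sign = (1 : ℝ[X]) := by
    rw [← Polynomial.C_mul, s.sign_mul_self, Polynomial.C_1]
  refine ⟨u, ⟨hdeg' ▸ hu, ?_⟩, ?_⟩
  · rw [negArg_eq_of_mul_add_mul_eq ha hi (hdeg ▸ hdeg' ▸ hu) hv huv]
    linear_combination huv + negArg a * v * hsign
  · rintro p ⟨hp, hp_eq⟩
    refine eq_of_mul_add_mul_eq (v := Polynomial.C s.sign * negArg p) (v' := v) ha
      (hdeg' ▸ hp) hu ?_
    rw [huv, ← hp_eq]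
    ring

/-! ### Interpolatory schemes -/

/-- A symbol is interpolatory if its mask satisfies `a_{2d} = δ_{d,0}`, so that the subdivision
operator keeps the old values at the even indices. -/
def IsInterpolatory (a : ℝ[T;T⁻¹]) : Prop :=
  ∀ d : ℤ, a.coeff (2 * d) = if d = 0 then 1 else 0

theorem coeff_toLaurent_natCast (P : ℝ[X]) (l : ℕ) : (toLaurent P).coeff l = P.coeff l := by
  rw [coeff_toLaurent]
  exact Finsupp.mapDomain_apply Nat.castEmbedding.injective _ _

theorem coeff_toLaurent_of_neg (P : ℝ[X]) {l : ℤ} (hl : l < 0) : (toLaurent P).coeff l = 0 := by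
  rw [coeff_toLaurent]
  refine Finsupp.mapDomain_of_notMem_range _ _ ?_
  rintro ⟨n, rfl⟩
  exact hl.not_ge (Int.natCast_nonneg n)

theorem coeff_interpSymbol (a : ℝ[X]) (s : Star) (i : ℕ) (p : ℝ[X]) (l : ℤ) :
    (interpSymbol a s i p).coeff l = (toLaurent (a * p)).coeff (l + (2 * i - s.ell)) := by
  rw [interpSymbol, LaurentPolynomial.T, AddMonoidAlgebra.coeff_mul_single_apply, mul_one, neg_neg]

theorem IsBezoutPoly.coeff_mul_two_mul {a p : ℝ[X]} {s : Star} {i : ℕ} (hi : 1 ≤ i)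
    (hp : IsBezoutPoly a s i p) {l : ℕ} (hl : Even l ↔ Even (2 * i - s.ell)) :
    (a * p).coeff l = if l = 2 * i - s.ell then 1 else 0 := by
  have hsign : s.sign * (-1) ^ l = 1 := by
    rw [neg_one_pow_congr hl, s.sign_mul_neg_one_pow hi]
  have hcoeff := congrArg (coeff · l) hp.2
  rw [negArg, negArg, ← mul_comp_neg_X, ← negArg] at hcoeff
  simp only [coeff_add, coeff_C_mul, coeff_negArg, ← Polynomial.C_ofNat, coeff_X_pow] at hcoeff
  rw [← mul_assoc, hsign, one_mul, ← two_mul] at hcoeff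
  exact mul_left_cancel₀ two_ne_zero hcoeff

theorem IsBezoutPoly.isInterpolatory {a p : ℝ[X]} {s : Star} {i : ℕ} (hi : 1 ≤ i)
    (hp : IsBezoutPoly a s i p) : IsInterpolatory (interpSymbol a s i p) := by
  intro d
  have hell : s.ell ≤ 2 * i := s.ell_le_two.trans (by omega)
  rw [coeff_interpSymbol]
  rcases lt_or_ge (2 * d + (2 * i - s.ell) : ℤ) 0 with hneg | hnonneg
  · rw [coeff_toLaurent_of_neg _ hneg, if_neg (by omega)]
  · obtain ⟨l, hl⟩ := Int.eq_ofNat_of_zero_le hnonneg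
    rw [hl, coeff_toLaurent_natCast, hp.coeff_mul_two_mul hi (by grind)]
    exact if_congr (by omega) rfl rfl

namespace IsInterpolatory

theorem subdivOp_two_mul {a : ℝ[T;T⁻¹]} (ha : IsInterpolatory a) (q : ℤ → ℂ) (i : ℤ) :
    subdivOp a q (2 * i) = q i := by
  rw [subdivOp, finsum_eq_single _ i]
  · rw [sub_self, ← mul_zero 2, ha 0, if_pos rfl, Complex.ofReal_one, one_mul]
  · intro j hj
    rw [← mul_sub, ha, if_neg (sub_ne_zero.2 hj.symm), Complex.ofReal_zero, zero_mul]

variable {a : ℕ → ℝ[T;T⁻¹]}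

theorem subdivData_two_pow_mul (ha : ∀ k, IsInterpolatory (a k)) (q : ℤ → ℂ) (k : ℕ) (i : ℤ) :
    subdivData a q k (2 ^ k * i) = q i := by
  induction k with
  | zero => rw [pow_zero, one_mul, subdivData]
  | succ k ih => rw [subdivData, pow_succ', mul_assoc, (ha k).subdivOp_two_mul, ih]

theorem limit_apply_add_intCast (ha : ∀ k, IsInterpolatory (a k)) {c : ℝ} {q : ℤ → ℂ}
    {g : ℝ → ℂ} (hg : IsLimitFunction (fun _ => c) a q g) (i : ℤ) : g (c + i) = q i := by
  have hpolygon : ∀ k, polygon (fun _ => c) k (subdivData a q k) (c + i) = q i := by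
    intro k
    have hu : (c + i - c) * 2 ^ k = ((2 ^ k * i : ℤ) : ℝ) := by push_cast; ring
    simp only [polygon, hu, Int.fract_intCast, Int.floor_intCast, subdivData_two_pow_mul ha]
    simp
  exact tendsto_nhds_unique (hg.tendsto_apply (c + i))
    (tendsto_const_nhds.congr fun k => (hpolygon k).symm)

end IsInterpolatory

theorem gridPoint_zero (τ : ℕ → ℝ) (i : ℤ) : gridPoint τ 0 i = τ 0 + i := by
  rw [gridPoint, pow_zero, div_one]

section

variable {T : ℕ} {γ : Fin (T + 1) → ℂ} {τ : ℕ → ℝ} {a c : ℕ → ℝ[T;T⁻¹]}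

theorem Generates.semiConv_mem (hgen : Generates τ a (expPolySpace T γ)) {φ : ℝ → ℂ}
    (hφ : IsLimitFunction τ a (Pi.single 0 1) φ) {f : ℝ → ℂ} (hf : f ∈ expPolySpace T γ) :
    semiConv (fun j => f j) φ ∈ expPolySpace T γ := by
  obtain ⟨g, hg, hlimit⟩ := hgen.2 _ (comp_add_const_mem_expPolySpace hf (-τ 0))
  simp only [gridPoint_zero, add_neg_cancel_comm] at hlimit
  exact hgen.1.eq_semiConv hφ hlimit ▸ hg

theorem Generates.reproduces_of_dvd (hγ : γ (Fin.last T) ≠ 0)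
    (hsep : ∀ θ θ' : ℂ, (charPoly γ).IsRoot θ → (charPoly γ).IsRoot θ' →
      Complex.exp θ = Complex.exp θ' → θ = θ')
    (hgen : Generates τ a (expPolySpace T γ)) (hdvd : ∀ k, a k ∣ c k)
    (hint : ∀ k, IsInterpolatory (c k)) {τ₀ : ℝ} (hconv : Convergent (fun _ => τ₀) c) :
    Reproduces (fun _ => τ₀) c (expPolySpace T γ) := by
  obtain ⟨φ, hφ⟩ := hgen.1.1 (Pi.single 0 1)
  obtain ⟨ψ, hψ⟩ := hconv.1 (Pi.single 0 1)
  refine ⟨hconv, fun f hf => ?_⟩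
  have hlimit := hconv.isLimitFunction_semiConv hψ
  have hinterp : ∀ (q : ℤ → ℂ) (i : ℤ), semiConv q ψ (τ₀ + i) = q i := fun q =>
    IsInterpolatory.limit_apply_add_intCast hint (hlimit q)
  have hzero : ∀ (n : ℕ) (θ : ℂ), (X - Polynomial.C θ) ^ n ∣ charPoly γ → ∀ m : ℤ, m ≠ 0 →
      n ≤ analyticOrderAt (laplace ψ) (θ + 2 * Real.pi * Complex.I * m) := fun n θ hθ m hm =>
    (le_analyticOrderAt_laplace_of_forall_semiConv_mem hγ hsep hφ.continuous
      (hgen.1.hasCompactSupport hφ) (fun f => hgen.semiConv_mem hφ) hθ hm).trans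
      (hgen.1.analyticOrderAt_laplace_le_of_dvd hφ hconv hψ hdvd _)
  have hf_eq := semiConv_eq_of_mem_expPolySpace hγ hψ.continuous (hconv.hasCompactSupport hψ)
    hinterp hzero hf
  simpa only [gridPoint_zero, hf_eq] using hlimit fun j => f (gridPoint (fun _ => τ₀) 0 j)

end

theorem toLaurent_dvd_interpSymbol (a : ℝ[X]) (s : Star) (i : ℕ) (p : ℝ[X]) :
    toLaurent a ∣ interpSymbol a s i p := by
  rw [interpSymbol, map_mul]
  exact (dvd_mul_right _ _).mul_right _

end ExpSubdivision

end

theorem mainTheorem1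
    (T : ℕ) (γ : Fin (T + 1) → ℂ) (hγ : γ (Fin.last T) ≠ 0)
    (hsep : ∀ θ θ' : ℂ, (ExpSubdivision.charPoly γ).IsRoot θ →
      (ExpSubdivision.charPoly γ).IsRoot θ' → Complex.exp θ = Complex.exp θ' → θ = θ')
    (a : ℕ → ℝ[X])
    (hcop : ∀ k, IsCoprime (a k) (ExpSubdivision.negArg (a k)))
    (τ : ℕ → ℝ)
    (hgen : ExpSubdivision.Generates τ (fun k => Polynomial.toLaurent (a k))
      (ExpSubdivision.expPolySpace T γ)) :
    (∀ (k : ℕ) (s : ExpSubdivision.Star) (i : ℕ), 1 ≤ i → i ≤ (a k).natDegree →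
      ∃! p : ℝ[X], ExpSubdivision.IsBezoutPoly (a k) s i p) ∧
    ∀ (s : ℕ → ExpSubdivision.Star) (i : ℕ → ℕ) (p : ℕ → ℝ[X]),
      (∀ k, 1 ≤ i k ∧ i k ≤ (a k).natDegree) →
      (∀ k, ExpSubdivision.IsBezoutPoly (a k) (s k) (i k) (p k)) →
      ∀ τ₀ : ℝ,
        ExpSubdivision.Convergent (fun _ => τ₀)
          (fun k => ExpSubdivision.interpSymbol (a k) (s k) (i k) (p k)) →
        ExpSubdivision.Reproduces (fun _ => τ₀)
          (fun k => ExpSubdivision.interpSymbol (a k) (s k) (i k) (p k))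
          (ExpSubdivision.expPolySpace T γ) :=
  ⟨fun k s _ hi hin => ExpSubdivision.existsUnique_isBezoutPoly (hcop k) s hi hin,
    fun s i p hi hp _ hconv => hgen.reproduces_of_dvd hγ hsep
      (fun k => ExpSubdivision.toLaurent_dvd_interpSymbol (a k) (s k) (i k) (p k))
      (fun k => (hp k).isInterpolatory (hi k).1) hconv⟩
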